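/- Let $K$ be a pathwise connected poset: $K\neq\emptyset$ and any two $a,b\in K$ are joined by a finite sequence $a=x_0,x_1,\dots,x_n=b$ in which any two consecutive elements $x_{i},x_{i+1}$ have a common upper bound in $K$. A *Hilbert net bundle* $\mathcal E$ over $K$ consists of finite-dimensional complex Hilbert spaces $E_a$ ($a\in K$) and unitaries $J_{ba}:E_a\to E_b$ for $a\le b$ with $J_{aa}=\mathrm{id}$ and $J_{cb}J_{ba}=J_{ca}$ for $a\le b\le c$; an isomorphism is a family of linear isomorphisms of the fibres commuting with the net structures $J$. Direct sums and tensor products, formed fibrewise, make the set of isomorphism classes a commutative semiring, and $K^0(K)$ is its Grothendieck ring. Let $G$ be a topological group acting on $K$ by poset automorphisms. A *Hilbert net $G$-bundle* over $K$ is a Hilbert net bundle $\mathcal E$ with a left action of $G$ on $\bigsqcup_a E_a$ which restricts to unitaries $g_a:E_a\to E_{ga}$ ($g\in G$, $a\in K$) with $g_b\,J_{ba}=J_{gb,ga}\,g_a$ for $a\le b$, and which is continuous in the sense that for all $a,b\in K$ and $v\in E_a$ the map $\{g\in G: ga=b\}\to E_b$, $g\mapsto g_a v$, is continuous. Isomorphisms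 are the $G$-equivariant isomorphisms of net bundles, and $K^0_G(K)$ is the Grothendieck ring of the semiring of isomorphism classes. $R(G)$ denotes the representation ring of $G$, the Grothendieck ring of the semiring of equivalence classes of finite-dimensional continuous unitary representations of $G$. For such a representation $H$ let $\mathcal T_H$ be the Hilbert net $G$-bundle with constant fibre $H$, identity maps as net structure and action $g(v,a)=(gv,ga)$. Suppose now that $G$ is compact and acts trivially on $K$. View a Hilbert net bundle as a Hilbert net $G$-bundle with the trivial action. For Hilbert net $G$-bundles $\mathcal E,\mathcal F$ let $B(\mathcal E,\mathcal F)_G$ be the Hilbert net bundle whose fibre over $a$ is the space of $G$-equivariant linear maps $E_a\to F_a$, with the inner product $\langle S,T\rangle=\mathrm{tr}(S^*T)$ and net structure $t\mapsto J^{\mathcal F}_{ba}\,t\,(J^{\mathcal E}_{ba})^{-1}$. **Theorem.** There is a ring isomorphism $$\Phi: K^0(K)\otimes_{\mathbb Z} R(G)\to K^0_G(K),\qquad \Phi([\mathcal E]\otimes[H])=[\mathcal T_H\otimes\mathcal E]$$ for every Hilbert net bundle $\mathcal E$ over $K$ and every finite-dimensional continuous unitary representation $H$ of $G$. Its inverse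 is given by the isotypic decomposition: choose a representative $H_\alpha$ of each equivalence class $\alpha$ of irreducible such representations and put $\mathcal T_\alpha=\mathcal T_{H_\alpha}$. Then for every Hilbert net $G$-bundle $\mathcal E$ the bundle $B(\mathcal T_\alpha,\mathcal E)_G$ is zero for all but finitely many $\alpha$, and $$\mathcal E\cong\bigoplus_\alpha \mathcal T_\alpha\otimes B(\mathcal T_\alpha,\mathcal E)_G,\qquad \Phi^{-1}([\mathcal E])=\sum_\alpha\,[B(\mathcal T_\alpha,\mathcal E)_G]\otimes[H_\alpha].$$ -/

import Mathlib

open scoped TensorProduct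

universe u v

/-! ### The Grothendieck ring of a commutative semiring -/

/-- The Grothendieck ring of a commutative semiring `S`: the Grothendieck group of `(S, +)`
(formal differences `x - y`), with the multiplication extended biadditively from `S`. -/
def GrothendieckRing (S : Type*) [CommSemiring S] : Type _ := Algebra.GrothendieckAddGroup S

namespace GrothendieckRing

variable {S : Type*} [CommSemiring S]

noncomputable instance : AddCommGroup (GrothendieckRing S) :=
  inferInstanceAs (AddCommGroup (Algebra.GrothendieckAddGroup S))

/-- The canonical map `x ↦ [x]` of a semiring into its Grothendieck ring. -/
noncomputable def of : S →+ GrothendieckRing S := Algebra.GrothendieckAddGroup.of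

/-- Additive maps from `S` to an abelian group extend to the Grothendieck group. -/
noncomputable def lift {A : Type*} [AddCommGroup A] (f : S →+ A) : GrothendieckRing S →+ A :=
  Algebra.GrothendieckAddGroup.lift f

theorem lift_of {A : Type*} [AddCommGroup A] (f : S →+ A) (x : S) : lift f (of x) = f x :=
  DFunLike.congr_fun (Algebra.GrothendieckAddGroup.lift.symm_apply_apply f) x

theorem exists_sub (z : GrothendieckRing S) : ∃ x y : S, z = of x - of y := by
  induction z using AddLocalization.ind with
  | _ p =>
    obtain ⟨x, y, hy⟩ := p
    refine ⟨x, y, ?_⟩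
    have h1 : (of x : GrothendieckRing S) = AddLocalization.mk x 0 := rfl
    have h2 : (of y : GrothendieckRing S) = AddLocalization.mk y 0 := rfl
    rw [h1, h2]
    refine Eq.trans ?_ (Algebra.GrothendieckAddGroup.mk_sub_mk x y 0 0).symm
    congr 1 <;> simp

/-- The biadditive extension of the multiplication of `S`. -/
noncomputable def mulHom : GrothendieckRing S →+ GrothendieckRing S →+ GrothendieckRing S :=
  lift
    { toFun := fun x => lift ((of (S := S)).comp (AddMonoidHom.mulLeft x))
      map_zero' := by
        ext z
        obtain ⟨x, y, rfl⟩ := exists_sub z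
        simp [lift_of]
      map_add' := fun a b => by
        ext z
        obtain ⟨x, y, rfl⟩ := exists_sub z
        simp only [map_sub, lift_of, AddMonoidHom.comp_apply, AddMonoidHom.coe_mulLeft,
          AddMonoidHom.add_apply, add_mul, map_add] }

noncomputable instance : NonUnitalNonAssocRing (GrothendieckRing S) :=
  { (inferInstance : AddCommGroup (GrothendieckRing S)) with
    mul := fun x y => mulHom x y
    left_distrib := fun x y z => map_add (mulHom x) y z
    right_distrib := fun x y z => by
      change mulHom (x + y) z = mulHom x z + mulHom y z
      rw [map_add, AddMonoidHom.add_apply]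
    zero_mul := fun x => by
      change mulHom 0 x = 0
      rw [map_zero, AddMonoidHom.zero_apply]
    mul_zero := fun x => map_zero (mulHom x) }

theorem of_mul_of (x y : S) : (of x * of y : GrothendieckRing S) = of (x * y) := by
  change mulHom (of x) (of y) = of (x * y)
  simp [mulHom, lift_of]

noncomputable instance : CommRing (GrothendieckRing S) :=
  { (inferInstance : NonUnitalNonAssocRing (GrothendieckRing S)) with
    one := of 1
    mul_assoc := fun x y z => by
      obtain ⟨x, x', rfl⟩ := exists_sub x
      obtain ⟨y, y', rfl⟩ := exists_sub y
      obtain ⟨z, z', rfl⟩ := exists_sub z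
      simp only [sub_mul, mul_sub, of_mul_of, mul_assoc]
    one_mul := fun x => by
      obtain ⟨x, x', rfl⟩ := exists_sub x
      change of 1 * (of x - of x') = _
      simp only [mul_sub, of_mul_of, one_mul]
    mul_one := fun x => by
      obtain ⟨x, x', rfl⟩ := exists_sub x
      change (of x - of x') * of 1 = _
      simp only [sub_mul, of_mul_of, mul_one]
    mul_comm := fun x y => by
      obtain ⟨x, x', rfl⟩ := exists_sub x
      obtain ⟨y, y', rfl⟩ := exists_sub y
      simp only [sub_mul, mul_sub, of_mul_of, mul_comm y x, mul_comm y x', mul_comm y' x,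
        mul_comm y' x']
      abel }

end GrothendieckRing

/-- A commutative semiring from a minimal set of axioms. -/
abbrev commSemiringOf (S : Type*) [Zero S] [One S] [Add S] [Mul S]
    (add_assoc : ∀ a b c : S, a + b + c = a + (b + c)) (zero_add : ∀ a : S, 0 + a = a)
    (add_comm : ∀ a b : S, a + b = b + a)
    (mul_assoc : ∀ a b c : S, a * b * c = a * (b * c)) (one_mul : ∀ a : S, 1 * a = a)
    (mul_comm : ∀ a b : S, a * b = b * a) (zero_mul : ∀ a : S, 0 * a = 0)
    (left_distrib : ∀ a b c : S, a * (b + c) = a * b + a * c) : CommSemiring S where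
  add_assoc := add_assoc
  zero_add := zero_add
  add_zero := fun a => by rw [add_comm, zero_add]
  add_comm := add_comm
  mul_assoc := mul_assoc
  one_mul := one_mul
  mul_one := fun a => by rw [mul_comm, one_mul]
  mul_comm := mul_comm
  zero_mul := zero_mul
  mul_zero := fun a => by rw [mul_comm, zero_mul]
  left_distrib := left_distrib
  right_distrib := fun a b c => by rw [mul_comm, left_distrib, mul_comm c, mul_comm c]
  nsmul := nsmulRec

/-! ### Natural isomorphisms of finite-dimensional Hilbert spaces

Direct sums are `WithLp 2 (V × W)` and tensor products carry the usual inner product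
`⟪v ⊗ w, v' ⊗ w'⟫ = ⟪v, v'⟫ ⟪w, w'⟫`. -/

namespace HilbertNat

section

variable {V V' W W' X X' : Type*}
  [NormedAddCommGroup V] [InnerProductSpace ℂ V] [NormedAddCommGroup V'] [InnerProductSpace ℂ V']
  [NormedAddCommGroup W] [InnerProductSpace ℂ W] [NormedAddCommGroup W'] [InnerProductSpace ℂ W']
  [NormedAddCommGroup X] [InnerProductSpace ℂ X] [NormedAddCommGroup X'] [InnerProductSpace ℂ X']

/-- The direct sum of two unitaries. -/
noncomputable abbrev sumMap (f : V ≃ₗᵢ[ℂ] V') (g : W ≃ₗᵢ[ℂ] W') :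
    WithLp 2 (V × W) ≃ₗᵢ[ℂ] WithLp 2 (V' × W') :=
  LinearIsometryEquiv.withLpProdCongr 2 f g

/-- The tensor product of two unitaries. -/
noncomputable abbrev tensMap (f : V ≃ₗᵢ[ℂ] V') (g : W ≃ₗᵢ[ℂ] W') :
    (V ⊗[ℂ] W) ≃ₗᵢ[ℂ] (V' ⊗[ℂ] W') :=
  TensorProduct.congrIsometry f g

/-- The direct sum of two linear isomorphisms. -/
noncomputable abbrev sumCongr (f : V ≃ₗ[ℂ] V') (g : W ≃ₗ[ℂ] W') :
    WithLp 2 (V × W) ≃ₗ[ℂ] WithLp 2 (V' × W') :=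
  (f.prodCongr g).withLpCongr 2

/-- `V ⊗ (W ⊕ X) ≃ (V ⊗ W) ⊕ (V ⊗ X)`. -/
noncomputable def distrib (V W X : Type*)
    [NormedAddCommGroup V] [InnerProductSpace ℂ V] [NormedAddCommGroup W] [InnerProductSpace ℂ W]
    [NormedAddCommGroup X] [InnerProductSpace ℂ X] :
    (V ⊗[ℂ] WithLp 2 (W × X)) ≃ₗ[ℂ] WithLp 2 ((V ⊗[ℂ] W) × (V ⊗[ℂ] X)) :=
  (TensorProduct.congr (LinearEquiv.refl ℂ V) (WithLp.linearEquiv 2 ℂ (W × X))).trans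
    ((TensorProduct.prodRight ℂ ℂ V W X).trans
      (WithLp.linearEquiv 2 ℂ ((V ⊗[ℂ] W) × (V ⊗[ℂ] X))).symm)

theorem distrib_nat (f : V ≃ₗᵢ[ℂ] V') (g : W ≃ₗᵢ[ℂ] W') (h : X ≃ₗᵢ[ℂ] X')
    (x : V ⊗[ℂ] WithLp 2 (W × X)) :
    distrib V' W' X' (tensMap f (sumMap g h) x)
      = sumMap (tensMap f g) (tensMap f h) (distrib V W X x) := by
  induction x with
  | zero => simp only [map_zero]
  | add x y hx hy => simp only [map_add, hx, hy]
  | tmul a b => rfl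

theorem assoc_nat (f : V ≃ₗᵢ[ℂ] V') (g : W ≃ₗᵢ[ℂ] W') (h : X ≃ₗᵢ[ℂ] X')
    (x : (V ⊗[ℂ] W) ⊗[ℂ] X) :
    TensorProduct.assocIsometry ℂ V' W' X' (tensMap (tensMap f g) h x)
      = tensMap f (tensMap g h) (TensorProduct.assocIsometry ℂ V W X x) := by
  induction x with
  | zero => simp
  | add x y hx hy => simp only [map_add, hx, hy]
  | tmul a b =>
    induction a with
    | zero => simp
    | add x y hx hy => simp only [map_add, hx, hy, TensorProduct.add_tmul]
    | tmul a c => rfl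

theorem comm_nat (f : V ≃ₗᵢ[ℂ] V') (g : W ≃ₗᵢ[ℂ] W') (x : V ⊗[ℂ] W) :
    TensorProduct.commIsometry ℂ V' W' (tensMap f g x)
      = tensMap g f (TensorProduct.commIsometry ℂ V W x) := by
  induction x with
  | zero => simp
  | add x y hx hy => simp only [map_add, hx, hy]
  | tmul a b => rfl

theorem lid_nat (f : V ≃ₗᵢ[ℂ] V') (x : ℂ ⊗[ℂ] V) :
    TensorProduct.lidIsometry ℂ V' (tensMap (LinearIsometryEquiv.refl ℂ ℂ) f x)
      = f (TensorProduct.lidIsometry ℂ V x) := by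
  induction x with
  | zero => simp
  | add x y hx hy => simp only [map_add, hx, hy]
  | tmul a b => simp

theorem congr_nat {Y Y' : Type*} [NormedAddCommGroup Y] [InnerProductSpace ℂ Y]
    [NormedAddCommGroup Y'] [InnerProductSpace ℂ Y']
    {s : V ≃ₗ[ℂ] W} {s' : V' ≃ₗ[ℂ] W'} {f : V ≃ₗᵢ[ℂ] V'} {f' : W ≃ₗᵢ[ℂ] W'}
    {t : X ≃ₗ[ℂ] Y} {t' : X' ≃ₗ[ℂ] Y'} {g : X ≃ₗᵢ[ℂ] X'} {g' : Y ≃ₗᵢ[ℂ] Y'}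
    (hs : ∀ v, s' (f v) = f' (s v)) (ht : ∀ v, t' (g v) = g' (t v)) (x : V ⊗[ℂ] X) :
    TensorProduct.congr s' t' (tensMap f g x) = tensMap f' g' (TensorProduct.congr s t x) := by
  induction x with
  | zero => simp
  | add x y hx hy => simp only [map_add, hx, hy]
  | tmul a b => simp [hs, ht]

theorem sumCongr_nat {Y Y' : Type*} [NormedAddCommGroup Y] [InnerProductSpace ℂ Y]
    [NormedAddCommGroup Y'] [InnerProductSpace ℂ Y']
    {s : V ≃ₗ[ℂ] W} {s' : V' ≃ₗ[ℂ] W'} {f : V ≃ₗᵢ[ℂ] V'} {f' : W ≃ₗᵢ[ℂ] W'}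
    {t : X ≃ₗ[ℂ] Y} {t' : X' ≃ₗ[ℂ] Y'} {g : X ≃ₗᵢ[ℂ] X'} {g' : Y ≃ₗᵢ[ℂ] Y'}
    (hs : ∀ v, s' (f v) = f' (s v)) (ht : ∀ v, t' (g v) = g' (t v)) (x : WithLp 2 (V × X)) :
    sumCongr s' t' (sumMap f g x) = sumMap f' g' (sumCongr s t x) := by
  apply (WithLp.linearEquiv 2 ℂ _).injective
  exact Prod.ext (hs _) (ht _)

/-- `0 ⊕ V ≃ V`. -/
noncomputable def zeroSum (V : Type*) [NormedAddCommGroup V] [InnerProductSpace ℂ V] :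
    WithLp 2 (EuclideanSpace ℂ (Fin 0) × V) ≃ₗ[ℂ] V where
  toFun := fun x => x.snd
  map_add' := fun _ _ => rfl
  map_smul' := fun _ _ => rfl
  invFun := fun v => WithLp.toLp 2 (0, v)
  left_inv := fun x => by
    apply (WithLp.linearEquiv 2 ℂ _).injective
    exact Prod.ext (Subsingleton.elim _ _) rfl
  right_inv := fun _ => rfl

/-- `0 ⊗ V ≃ 0`. -/
noncomputable def zeroTens (V : Type*) [NormedAddCommGroup V] [InnerProductSpace ℂ V] :
    (EuclideanSpace ℂ (Fin 0) ⊗[ℂ] V) ≃ₗ[ℂ] EuclideanSpace ℂ (Fin 0) where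
  toFun := fun _ => 0
  map_add' := fun _ _ => by simp
  map_smul' := fun _ _ => by simp
  invFun := fun _ => 0
  left_inv := fun x => by
    induction x with
    | zero => rfl
    | add x y hx hy => rw [← hx, ← hy]; simp
    | tmul a b => rw [Subsingleton.elim a 0, TensorProduct.zero_tmul]
  right_inv := fun x => Subsingleton.elim _ _

theorem tensMap_trans {V'' W'' : Type*} [NormedAddCommGroup V''] [InnerProductSpace ℂ V'']
    [NormedAddCommGroup W''] [InnerProductSpace ℂ W'']
    {f : V ≃ₗᵢ[ℂ] V'} {f' : V' ≃ₗᵢ[ℂ] V''} {f'' : V ≃ₗᵢ[ℂ] V''}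
    {g : W ≃ₗᵢ[ℂ] W'} {g' : W' ≃ₗᵢ[ℂ] W''} {g'' : W ≃ₗᵢ[ℂ] W''}
    (hf : ∀ v, f' (f v) = f'' v) (hg : ∀ v, g' (g v) = g'' v) (x : V ⊗[ℂ] W) :
    tensMap f' g' (tensMap f g x) = tensMap f'' g'' x := by
  induction x with
  | zero => simp
  | add x y hx hy => simp only [map_add, hx, hy]
  | tmul a b => simp [hf, hg]

theorem sumMap_trans {V'' W'' : Type*} [NormedAddCommGroup V''] [InnerProductSpace ℂ V'']
    [NormedAddCommGroup W''] [InnerProductSpace ℂ W'']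
    {f : V ≃ₗᵢ[ℂ] V'} {f' : V' ≃ₗᵢ[ℂ] V''} {f'' : V ≃ₗᵢ[ℂ] V''}
    {g : W ≃ₗᵢ[ℂ] W'} {g' : W' ≃ₗᵢ[ℂ] W''} {g'' : W ≃ₗᵢ[ℂ] W''}
    (hf : ∀ v, f' (f v) = f'' v) (hg : ∀ v, g' (g v) = g'' v) (x : WithLp 2 (V × W)) :
    sumMap f' g' (sumMap f g x) = sumMap f'' g'' x := by
  apply (WithLp.linearEquiv 2 ℂ _).injective
  exact Prod.ext (hf _) (hg _)

theorem tensMap_id {f : V ≃ₗᵢ[ℂ] V} {g : W ≃ₗᵢ[ℂ] W} (hf : ∀ v, f v = v) (hg : ∀ v, g v = v)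
    (x : V ⊗[ℂ] W) : tensMap f g x = x := by
  induction x with
  | zero => simp
  | add x y hx hy => simp only [map_add, hx, hy]
  | tmul a b => simp [hf, hg]

theorem sumMap_id {f : V ≃ₗᵢ[ℂ] V} {g : W ≃ₗᵢ[ℂ] W} (hf : ∀ v, f v = v) (hg : ∀ v, g v = v)
    (x : WithLp 2 (V × W)) : sumMap f g x = x := by
  apply (WithLp.linearEquiv 2 ℂ _).injective
  exact Prod.ext (hf _) (hg _)

theorem sumMap_square {V₁ V₂ V₃ V₄ W₁ W₂ W₃ W₄ : Type*}
    [NormedAddCommGroup V₁] [InnerProductSpace ℂ V₁] [NormedAddCommGroup V₂]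
    [InnerProductSpace ℂ V₂] [NormedAddCommGroup V₃] [InnerProductSpace ℂ V₃]
    [NormedAddCommGroup V₄] [InnerProductSpace ℂ V₄] [NormedAddCommGroup W₁]
    [InnerProductSpace ℂ W₁] [NormedAddCommGroup W₂] [InnerProductSpace ℂ W₂]
    [NormedAddCommGroup W₃] [InnerProductSpace ℂ W₃] [NormedAddCommGroup W₄]
    [InnerProductSpace ℂ W₄]
    {f : V₁ ≃ₗᵢ[ℂ] V₂} {f' : V₂ ≃ₗᵢ[ℂ] V₄} {k : V₁ ≃ₗᵢ[ℂ] V₃} {k' : V₃ ≃ₗᵢ[ℂ] V₄}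
    {g : W₁ ≃ₗᵢ[ℂ] W₂} {g' : W₂ ≃ₗᵢ[ℂ] W₄} {l : W₁ ≃ₗᵢ[ℂ] W₃} {l' : W₃ ≃ₗᵢ[ℂ] W₄}
    (hf : ∀ v, f' (f v) = k' (k v)) (hg : ∀ v, g' (g v) = l' (l v)) (x : WithLp 2 (V₁ × W₁)) :
    sumMap f' g' (sumMap f g x) = sumMap k' l' (sumMap k l x) := by
  apply (WithLp.linearEquiv 2 ℂ _).injective
  exact Prod.ext (hf _) (hg _)

theorem tensMap_square {V₁ V₂ V₃ V₄ W₁ W₂ W₃ W₄ : Type*}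
    [NormedAddCommGroup V₁] [InnerProductSpace ℂ V₁] [NormedAddCommGroup V₂]
    [InnerProductSpace ℂ V₂] [NormedAddCommGroup V₃] [InnerProductSpace ℂ V₃]
    [NormedAddCommGroup V₄] [InnerProductSpace ℂ V₄] [NormedAddCommGroup W₁]
    [InnerProductSpace ℂ W₁] [NormedAddCommGroup W₂] [InnerProductSpace ℂ W₂]
    [NormedAddCommGroup W₃] [InnerProductSpace ℂ W₃] [NormedAddCommGroup W₄]
    [InnerProductSpace ℂ W₄]
    {f : V₁ ≃ₗᵢ[ℂ] V₂} {f' : V₂ ≃ₗᵢ[ℂ] V₄} {k : V₁ ≃ₗᵢ[ℂ] V₃} {k' : V₃ ≃ₗᵢ[ℂ] V₄}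
    {g : W₁ ≃ₗᵢ[ℂ] W₂} {g' : W₂ ≃ₗᵢ[ℂ] W₄} {l : W₁ ≃ₗᵢ[ℂ] W₃} {l' : W₃ ≃ₗᵢ[ℂ] W₄}
    (hf : ∀ v, f' (f v) = k' (k v)) (hg : ∀ v, g' (g v) = l' (l v)) (x : V₁ ⊗[ℂ] W₁) :
    tensMap f' g' (tensMap f g x) = tensMap k' l' (tensMap k l x) := by
  induction x with
  | zero => simp
  | add x y hx hy => simp only [map_add, hx, hy]
  | tmul a b => simp [hf, hg]

theorem continuous_sumMap {Y : Type*} [TopologicalSpace Y] {f : Y → V ≃ₗᵢ[ℂ] V'}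
    {g : Y → W ≃ₗᵢ[ℂ] W'} (hf : ∀ v, Continuous fun y => f y v)
    (hg : ∀ v, Continuous fun y => g y v) (x : WithLp 2 (V × W)) :
    Continuous fun y => sumMap (f y) (g y) x :=
  (WithLp.prod_continuous_toLp 2 V' W').comp ((hf x.fst).prodMk (hg x.snd))

theorem continuous_tensMap {Y : Type*} [TopologicalSpace Y] {f : Y → V ≃ₗᵢ[ℂ] V'}
    {g : Y → W ≃ₗᵢ[ℂ] W'} (hf : ∀ v, Continuous fun y => f y v)
    (hg : ∀ v, Continuous fun y => g y v) (x : V ⊗[ℂ] W) :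
    Continuous fun y => tensMap (f y) (g y) x := by
  induction x with
  | zero => simpa using continuous_const
  | add x y hx hy =>
    simp only [map_add]
    exact hx.add hy
  | tmul a b => exact TensorProduct.continuous_tmul.comp ((hf a).prodMk (hg b))

end

/-! #### The Hilbert–Schmidt inner product `⟪S, T⟫ = tr (S* T)` on spaces of linear maps -/

section

variable {V W : Type*} [NormedAddCommGroup V] [InnerProductSpace ℂ V] [FiniteDimensional ℂ V]
  [NormedAddCommGroup W] [InnerProductSpace ℂ W] [FiniteDimensional ℂ W]

theorem trace_adjoint_comp {ι : Type*} [Fintype ι] (b : OrthonormalBasis ι ℂ V)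
    (S T : V →ₗ[ℂ] W) :
    LinearMap.trace ℂ V (LinearMap.adjoint S ∘ₗ T) = ∑ i, inner ℂ (S (b i)) (T (b i)) := by
  classical
  rw [LinearMap.trace_eq_sum_inner _ b]
  simp [LinearMap.adjoint_inner_right]

/-- The Hilbert–Schmidt inner product on a space `p` of linear maps. -/
@[reducible] noncomputable def hsCore (p : Submodule ℂ (V →ₗ[ℂ] W)) : InnerProductSpace.Core ℂ p where
  inner S T := LinearMap.trace ℂ V (LinearMap.adjoint S.1 ∘ₗ T.1)
  conj_inner_symm S T := by
    simp only [trace_adjoint_comp (stdOrthonormalBasis ℂ V), map_sum, inner_conj_symm]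
  re_inner_nonneg S := by
    simp only [trace_adjoint_comp (stdOrthonormalBasis ℂ V), map_sum]
    exact Finset.sum_nonneg fun i _ => inner_self_nonneg
  add_left S T R := by
    simp only [trace_adjoint_comp (stdOrthonormalBasis ℂ V), Submodule.coe_add,
      LinearMap.add_apply, inner_add_left, Finset.sum_add_distrib]
  smul_left S T r := by
    simp only [trace_adjoint_comp (stdOrthonormalBasis ℂ V), Submodule.coe_smul,
      LinearMap.smul_apply, inner_smul_left, Finset.mul_sum]
  definite S h := by
    simp only [trace_adjoint_comp (stdOrthonormalBasis ℂ V)] at h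
    have h' := congrArg (RCLike.re (K := ℂ)) h
    rw [map_sum, map_zero, Finset.sum_eq_zero_iff_of_nonneg
      (fun i _ => inner_self_nonneg (𝕜 := ℂ) (x := S.1 (stdOrthonormalBasis ℂ V i)))] at h'
    apply Subtype.ext
    apply (stdOrthonormalBasis ℂ V).toBasis.ext
    intro i
    have := h' i (Finset.mem_univ i)
    rw [OrthonormalBasis.coe_toBasis]
    exact inner_self_eq_zero.1 (Complex.ext this (inner_self_im (𝕜 := ℂ) _))

noncomputable abbrev hsNormed (p : Submodule ℂ (V →ₗ[ℂ] W)) : NormedAddCommGroup p :=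
  (hsCore p).toNormedAddCommGroup

attribute [local instance] hsNormed

noncomputable abbrev hsInner (p : Submodule ℂ (V →ₗ[ℂ] W)) : InnerProductSpace ℂ p :=
  InnerProductSpace.ofCore (hsCore p).toCore

attribute [local instance] hsInner

/-- A unitary `J` of `V` onto `V'` and a unitary `J'` of `W` onto `W'` give the unitary
`t ↦ J' t J⁻¹` between spaces of linear maps that correspond to each other. -/
noncomputable def hsConj {V' W' : Type*} [NormedAddCommGroup V'] [InnerProductSpace ℂ V']
    [FiniteDimensional ℂ V'] [NormedAddCommGroup W'] [InnerProductSpace ℂ W']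
    [FiniteDimensional ℂ W'] (p : Submodule ℂ (V →ₗ[ℂ] W)) (p' : Submodule ℂ (V' →ₗ[ℂ] W'))
    (J : V ≃ₗᵢ[ℂ] V') (J' : W ≃ₗᵢ[ℂ] W')
    (h : ∀ t ∈ p, J'.toLinearEquiv.toLinearMap ∘ₗ t ∘ₗ J.symm.toLinearEquiv.toLinearMap ∈ p')
    (h' : ∀ t ∈ p', J'.symm.toLinearEquiv.toLinearMap ∘ₗ t ∘ₗ J.toLinearEquiv.toLinearMap ∈ p) :
    p ≃ₗᵢ[ℂ] p' :=
  LinearEquiv.isometryOfInner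
    { toFun := fun t => ⟨_, h t.1 t.2⟩
      invFun := fun t => ⟨_, h' t.1 t.2⟩
      map_add' := fun s t => by ext; simp
      map_smul' := fun r t => by ext; simp
      left_inv := fun t => by ext; simp
      right_inv := fun t => by ext; simp }
    (fun S T => by
      change LinearMap.trace ℂ V' _ = LinearMap.trace ℂ V _
      rw [trace_adjoint_comp ((stdOrthonormalBasis ℂ V).map J),
        trace_adjoint_comp (stdOrthonormalBasis ℂ V)]
      simp)

end

end HilbertNat

open HilbertNat

/-! ### Posets -/

/-- A poset is pathwise connected: it is non-empty, and any two elements are joined by a path of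
1-simplices `(o; x, y)`, that is, of pairs `x, y` with a support `o` such that `x ≤ o`, `y ≤ o`. -/
def PathwiseConnected (K : Type u) [PartialOrder K] : Prop :=
  Nonempty K ∧ ∀ a b : K, Relation.ReflTransGen (fun x y => ∃ o, x ≤ o ∧ y ≤ o) a b

/-! ### Hilbert net bundles -/

/-- A (finite-dimensional) Hilbert net bundle over a poset `K`: a finite-dimensional Hilbert space
`fib a` for every `a : K`, and unitaries `J : fib a → fib b` for `a ≤ b` satisfying the cocycle
relations. (Up to isomorphism, finite-dimensional Hilbert spaces live in `Type`; over a pathwise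
connected poset the dimension of the fibres is constant.) -/
structure HilbertNetBundle (K : Type u) [PartialOrder K] where
  fib : K → Type
  [grp : ∀ a, NormedAddCommGroup (fib a)]
  [ips : ∀ a, InnerProductSpace ℂ (fib a)]
  [fin : ∀ a, FiniteDimensional ℂ (fib a)]
  J : ∀ {a b : K}, a ≤ b → fib a ≃ₗᵢ[ℂ] fib b
  J_refl : ∀ (a : K) (v : fib a), J (le_refl a) v = v
  J_trans : ∀ {a b c : K} (hab : a ≤ b) (hbc : b ≤ c) (v : fib a),
    J hbc (J hab v) = J (hab.trans hbc) v

attribute [instance] HilbertNetBundle.grp HilbertNetBundle.ips HilbertNetBundle.fin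

namespace HilbertNetBundle

variable {K : Type u} [PartialOrder K]

/-- Isomorphism of Hilbert net bundles: a family of linear isomorphisms of the fibres which
intertwines the net structures. -/
def Isomorphic (E F : HilbertNetBundle K) : Prop :=
  ∃ T : ∀ a, E.fib a ≃ₗ[ℂ] F.fib a,
    ∀ (a b : K) (h : a ≤ b) (v : E.fib a), T b (E.J h v) = F.J h (T a v)

/-- The zero bundle. -/
noncomputable def zero : HilbertNetBundle K where
  fib := fun _ => EuclideanSpace ℂ (Fin 0)
  J := fun _ => LinearIsometryEquiv.refl ℂ _
  J_refl := fun _ _ => rfl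
  J_trans := fun _ _ _ => rfl

/-- The trivial bundle of rank one. -/
noncomputable def unit : HilbertNetBundle K where
  fib := fun _ => ℂ
  J := fun _ => LinearIsometryEquiv.refl ℂ _
  J_refl := fun _ _ => rfl
  J_trans := fun _ _ _ => rfl

/-- The direct sum. -/
noncomputable def sum (E F : HilbertNetBundle K) : HilbertNetBundle K where
  fib := fun a => WithLp 2 (E.fib a × F.fib a)
  J := fun h => sumMap (E.J h) (F.J h)
  J_refl := fun a => sumMap_id (E.J_refl a) (F.J_refl a)
  J_trans := fun h h' => sumMap_trans (E.J_trans h h') (F.J_trans h h')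

/-- The tensor product. -/
noncomputable def tensor (E F : HilbertNetBundle K) : HilbertNetBundle K where
  fib := fun a => E.fib a ⊗[ℂ] F.fib a
  J := fun h => tensMap (E.J h) (F.J h)
  J_refl := fun a => tensMap_id (E.J_refl a) (F.J_refl a)
  J_trans := fun h h' => tensMap_trans (E.J_trans h h') (F.J_trans h h')

instance setoid : Setoid (HilbertNetBundle K) where
  r := Isomorphic
  iseqv :=
    { refl := fun E => ⟨fun _ => LinearEquiv.refl ℂ _, fun _ _ _ _ => rfl⟩
      symm := fun ⟨T, hT⟩ => ⟨fun a => (T a).symm, fun a b h v => by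
        rw [LinearEquiv.symm_apply_eq, hT, LinearEquiv.apply_symm_apply]⟩
      trans := fun ⟨T, hT⟩ ⟨S, hS⟩ => ⟨fun a => (T a).trans (S a), fun a b h v => by
        simp only [LinearEquiv.trans_apply, hT, hS]⟩ }

end HilbertNetBundle

/-- The semiring of isomorphism classes of Hilbert net bundles over `K`. -/
def VNet (K : Type u) [PartialOrder K] : Type (max 1 u) :=
  Quotient (HilbertNetBundle.setoid (K := K))

namespace VNet

variable {K : Type u} [PartialOrder K]

/-- The isomorphism class `{E}`. -/
def mk (E : HilbertNetBundle K) : VNet K := Quotient.mk _ E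

noncomputable instance : Zero (VNet K) := ⟨mk HilbertNetBundle.zero⟩

noncomputable instance : One (VNet K) := ⟨mk HilbertNetBundle.unit⟩

noncomputable instance : Add (VNet K) :=
  ⟨Quotient.map₂ HilbertNetBundle.sum fun _ _ ⟨T, hT⟩ _ _ ⟨S, hS⟩ =>
    ⟨fun a => sumCongr (T a) (S a), fun a b h => sumCongr_nat (hT a b h) (hS a b h)⟩⟩

noncomputable instance : Mul (VNet K) :=
  ⟨Quotient.map₂ HilbertNetBundle.tensor fun _ _ ⟨T, hT⟩ _ _ ⟨S, hS⟩ =>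
    ⟨fun a => TensorProduct.congr (T a) (S a), fun a b h => congr_nat (hT a b h) (hS a b h)⟩⟩

noncomputable instance : CommSemiring (VNet K) :=
  commSemiringOf (VNet K)
    (by
      rintro ⟨E⟩ ⟨F⟩ ⟨H⟩
      exact Quotient.sound ⟨fun _ => (LinearIsometryEquiv.withLpProdAssoc 2 ℂ _ _ _).toLinearEquiv,
        fun _ _ _ _ => rfl⟩)
    (by
      rintro ⟨E⟩
      exact Quotient.sound ⟨fun _ => zeroSum _, fun _ _ _ _ => rfl⟩)
    (by
      rintro ⟨E⟩ ⟨F⟩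
      exact Quotient.sound ⟨fun _ => (LinearIsometryEquiv.withLpProdComm 2 ℂ _ _).toLinearEquiv,
        fun _ _ _ _ => rfl⟩)
    (by
      rintro ⟨E⟩ ⟨F⟩ ⟨H⟩
      exact Quotient.sound ⟨fun _ => (TensorProduct.assocIsometry ℂ _ _ _).toLinearEquiv,
        fun _ _ _ => assoc_nat _ _ _⟩)
    (by
      rintro ⟨E⟩
      exact Quotient.sound ⟨fun _ => (TensorProduct.lidIsometry ℂ _).toLinearEquiv,
        fun _ _ _ => lid_nat _⟩)
    (by
      rintro ⟨E⟩ ⟨F⟩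
      exact Quotient.sound ⟨fun _ => (TensorProduct.commIsometry ℂ _ _).toLinearEquiv,
        fun _ _ _ => comm_nat _ _⟩)
    (by
      rintro ⟨E⟩
      exact Quotient.sound ⟨fun _ => zeroTens _,
        fun _ _ _ _ => Subsingleton.elim (α := EuclideanSpace ℂ (Fin 0)) _ _⟩)
    (by
      rintro ⟨E⟩ ⟨F⟩ ⟨H⟩
      exact Quotient.sound ⟨fun _ => distrib _ _ _, fun _ _ _ => distrib_nat _ _ _⟩)

end VNet

/-- The K-theory `K⁰(K)`: the Grothendieck ring of the semiring of isomorphism classes of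
Hilbert net bundles over `K`. -/
abbrev K0 (K : Type u) [PartialOrder K] : Type (max 1 u) := GrothendieckRing (VNet K)

/-- The class `[E] ∈ K⁰(K)`. -/
noncomputable def HilbertNetBundle.cls {K : Type u} [PartialOrder K] (E : HilbertNetBundle K) :
    K0 K :=
  GrothendieckRing.of (VNet.mk E)

/-! ### The representation ring -/

/-- A finite-dimensional continuous unitary representation of `G`. -/
structure UnitaryRep (G : Type v) [Group G] [TopologicalSpace G] where
  V : Type
  [grp : NormedAddCommGroup V]
  [ips : InnerProductSpace ℂ V]
  [fin : FiniteDimensional ℂ V]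
  ρ : G → V ≃ₗᵢ[ℂ] V
  map_one : ∀ v, ρ 1 v = v
  map_mul : ∀ g h v, ρ g (ρ h v) = ρ (g * h) v
  continuous : ∀ v, Continuous fun g => ρ g v

attribute [instance] UnitaryRep.grp UnitaryRep.ips UnitaryRep.fin

namespace UnitaryRep

variable {G : Type v} [Group G] [TopologicalSpace G]

/-- Equivalence of representations. -/
def Isomorphic (H H' : UnitaryRep G) : Prop :=
  ∃ T : H.V ≃ₗ[ℂ] H'.V, ∀ (g : G) (v : H.V), T (H.ρ g v) = H'.ρ g (T v)

/-- A representation is irreducible if it is non-zero and has no invariant subspaces besides `0`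
and the whole space. -/
def IsIrreducible (H : UnitaryRep G) : Prop :=
  Nontrivial H.V ∧
    ∀ W : Submodule ℂ H.V, (∀ g, ∀ v ∈ W, H.ρ g v ∈ W) → W = ⊥ ∨ W = ⊤

/-- The zero representation. -/
noncomputable def zero : UnitaryRep G where
  V := EuclideanSpace ℂ (Fin 0)
  ρ := fun _ => LinearIsometryEquiv.refl ℂ _
  map_one := fun _ => rfl
  map_mul := fun _ _ _ => rfl
  continuous := fun _ => continuous_const

/-- The trivial one-dimensional representation. -/
noncomputable def unit : UnitaryRep G where
  V := ℂ
  ρ := fun _ => LinearIsometryEquiv.refl ℂ _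
  map_one := fun _ => rfl
  map_mul := fun _ _ _ => rfl
  continuous := fun _ => continuous_const

/-- The direct sum. -/
noncomputable def sum (H H' : UnitaryRep G) : UnitaryRep G where
  V := WithLp 2 (H.V × H'.V)
  ρ := fun g => sumMap (H.ρ g) (H'.ρ g)
  map_one := sumMap_id H.map_one H'.map_one
  map_mul := fun g h => sumMap_trans (H.map_mul g h) (H'.map_mul g h)
  continuous := continuous_sumMap H.continuous H'.continuous

/-- The tensor product. -/
noncomputable def tensor (H H' : UnitaryRep G) : UnitaryRep G where
  V := H.V ⊗[ℂ] H'.V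
  ρ := fun g => tensMap (H.ρ g) (H'.ρ g)
  map_one := tensMap_id H.map_one H'.map_one
  map_mul := fun g h => tensMap_trans (H.map_mul g h) (H'.map_mul g h)
  continuous := continuous_tensMap H.continuous H'.continuous

instance setoid : Setoid (UnitaryRep G) where
  r := Isomorphic
  iseqv :=
    { refl := fun H => ⟨LinearEquiv.refl ℂ _, fun _ _ => rfl⟩
      symm := fun ⟨T, hT⟩ => ⟨T.symm, fun g v => by
        rw [LinearEquiv.symm_apply_eq, hT, LinearEquiv.apply_symm_apply]⟩
      trans := fun ⟨T, hT⟩ ⟨S, hS⟩ => ⟨T.trans S, fun g v => by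
        simp only [LinearEquiv.trans_apply, hT, hS]⟩ }

end UnitaryRep

/-- The semiring of equivalence classes of representations of `G`. -/
def RepClass (G : Type v) [Group G] [TopologicalSpace G] : Type (max 1 v) :=
  Quotient (UnitaryRep.setoid (G := G))

namespace RepClass

variable {G : Type v} [Group G] [TopologicalSpace G]

/-- The equivalence class of a representation. -/
def mk (H : UnitaryRep G) : RepClass G := Quotient.mk _ H

noncomputable instance : Zero (RepClass G) := ⟨mk UnitaryRep.zero⟩

noncomputable instance : One (RepClass G) := ⟨mk UnitaryRep.unit⟩

noncomputable instance : Add (RepClass G) :=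
  ⟨Quotient.map₂ UnitaryRep.sum fun _ _ ⟨T, hT⟩ _ _ ⟨S, hS⟩ =>
    ⟨sumCongr T S, fun g => sumCongr_nat (hT g) (hS g)⟩⟩

noncomputable instance : Mul (RepClass G) :=
  ⟨Quotient.map₂ UnitaryRep.tensor fun _ _ ⟨T, hT⟩ _ _ ⟨S, hS⟩ =>
    ⟨TensorProduct.congr T S, fun g => congr_nat (hT g) (hS g)⟩⟩

noncomputable instance : CommSemiring (RepClass G) :=
  commSemiringOf (RepClass G)
    (by
      rintro ⟨E⟩ ⟨F⟩ ⟨H⟩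
      exact Quotient.sound ⟨(LinearIsometryEquiv.withLpProdAssoc 2 ℂ _ _ _).toLinearEquiv,
        fun _ _ => rfl⟩)
    (by
      rintro ⟨E⟩
      exact Quotient.sound ⟨zeroSum _, fun _ _ => rfl⟩)
    (by
      rintro ⟨E⟩ ⟨F⟩
      exact Quotient.sound ⟨(LinearIsometryEquiv.withLpProdComm 2 ℂ _ _).toLinearEquiv,
        fun _ _ => rfl⟩)
    (by
      rintro ⟨E⟩ ⟨F⟩ ⟨H⟩
      exact Quotient.sound ⟨(TensorProduct.assocIsometry ℂ _ _ _).toLinearEquiv,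
        fun _ => assoc_nat _ _ _⟩)
    (by
      rintro ⟨E⟩
      exact Quotient.sound ⟨(TensorProduct.lidIsometry ℂ _).toLinearEquiv,
        fun _ => lid_nat _⟩)
    (by
      rintro ⟨E⟩ ⟨F⟩
      exact Quotient.sound ⟨(TensorProduct.commIsometry ℂ _ _).toLinearEquiv,
        fun _ => comm_nat _ _⟩)
    (by
      rintro ⟨E⟩
      exact Quotient.sound ⟨zeroTens _,
        fun _ _ => Subsingleton.elim (α := EuclideanSpace ℂ (Fin 0)) _ _⟩)
    (by
      rintro ⟨E⟩ ⟨F⟩ ⟨H⟩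
      exact Quotient.sound ⟨distrib _ _ _, fun _ => distrib_nat _ _ _⟩)

end RepClass

/-- The representation ring `R(G)`. -/
abbrev RepRing (G : Type v) [Group G] [TopologicalSpace G] : Type (max 1 v) :=
  GrothendieckRing (RepClass G)

/-- The class `[H] ∈ R(G)`. -/
noncomputable def UnitaryRep.cls {G : Type v} [Group G] [TopologicalSpace G] (H : UnitaryRep G) :
    RepRing G :=
  GrothendieckRing.of (RepClass.mk H)

/-- The equivalence classes of irreducible representations of `G`. -/
abbrev Irr (G : Type v) [Group G] [TopologicalSpace G] : Type (max 1 v) :=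
  {c : RepClass G // ∃ H : UnitaryRep G, H.IsIrreducible ∧ RepClass.mk H = c}

/-! ### Hilbert net `G`-bundles -/

/-- A (finite-dimensional) Hilbert net `G`-bundle over a poset `K` on which `G` acts (by poset
automorphisms): a Hilbert net bundle with a left action of `G` on the total space which covers the
action on `K`, is unitary on the fibres and commutes with the net structure. The unitary
`g_a : fib a → fib (g • a)` is `act g h : fib a → fib b` with `h : g • a = b`. The action is
continuous: `g ↦ g v ∈ fib b` is continuous on `{g | g • a = b}` for every `v : fib a`. -/
structure HilbertNetGBundle (G : Type v) [Group G] [TopologicalSpace G]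
    (K : Type u) [PartialOrder K] [MulAction G K] extends HilbertNetBundle K where
  act : ∀ (g : G) {a b : K}, g • a = b → fib a ≃ₗᵢ[ℂ] fib b
  act_one : ∀ (a : K) (v : fib a), act 1 (one_smul G a) v = v
  act_mul : ∀ (g h : G) {a b c : K} (hab : h • a = b) (hbc : g • b = c) (v : fib a),
    act g hbc (act h hab v) = act (g * h) (by rw [mul_smul, hab, hbc]) v
  act_J : ∀ (g : G) {a b a' b' : K} (ha : g • a = a') (hb : g • b = b') (h : a ≤ b)
    (h' : a' ≤ b') (v : fib a), act g hb (J h v) = J h' (act g ha v)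
  act_continuous : ∀ (a b : K) (v : fib a),
    Continuous fun g : {g : G // g • a = b} => act g.1 g.2 v

namespace HilbertNetGBundle

variable {G : Type v} [Group G] [TopologicalSpace G]
  {K : Type u} [PartialOrder K] [MulAction G K]

/-- Isomorphism of Hilbert net `G`-bundles: an equivariant isomorphism of net bundles. -/
def Isomorphic (E F : HilbertNetGBundle G K) : Prop :=
  ∃ T : ∀ a, E.fib a ≃ₗ[ℂ] F.fib a,
    (∀ (a b : K) (h : a ≤ b) (v : E.fib a), T b (E.J h v) = F.J h (T a v)) ∧
    ∀ (g : G) (a b : K) (h : g • a = b) (v : E.fib a), T b (E.act g h v) = F.act g h (T a v)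

/-- The zero `G`-bundle. -/
noncomputable def zero : HilbertNetGBundle G K where
  toHilbertNetBundle := HilbertNetBundle.zero
  act := fun _ _ _ _ => LinearIsometryEquiv.refl ℂ (EuclideanSpace ℂ (Fin 0))
  act_one := fun _ _ => rfl
  act_mul := fun _ _ _ _ _ _ _ _ => rfl
  act_J := fun _ _ _ _ _ _ _ _ _ _ => rfl
  act_continuous := fun _ _ _ => continuous_const

/-- The bundle `T_H = H × K` of a unitary representation `H` of `G`: the constant net bundle with
fibre `H`, on which `G` acts by `g (v, a) = (g v, g a)`. -/
noncomputable def ofRep (K : Type u) [PartialOrder K] [MulAction G K] (H : UnitaryRep G) :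
    HilbertNetGBundle G K where
  fib := fun _ => H.V
  J := fun _ => LinearIsometryEquiv.refl ℂ _
  J_refl := fun _ _ => rfl
  J_trans := fun _ _ _ => rfl
  act := fun g _ _ _ => H.ρ g
  act_one := fun _ => H.map_one
  act_mul := fun g h _ _ _ _ _ => H.map_mul g h
  act_J := fun _ _ _ _ _ _ _ _ _ _ => rfl
  act_continuous := fun _ _ v => (H.continuous v).comp continuous_subtype_val

/-- The trivial bundle of rank one, with the trivial action on `ℂ`. -/
noncomputable def unit : HilbertNetGBundle G K := ofRep K UnitaryRep.unit

/-- The direct sum. -/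
noncomputable def sum (E F : HilbertNetGBundle G K) : HilbertNetGBundle G K where
  toHilbertNetBundle := E.toHilbertNetBundle.sum F.toHilbertNetBundle
  act := fun g _ _ h => sumMap (E.act g h) (F.act g h)
  act_one := fun a => sumMap_id (E.act_one a) (F.act_one a)
  act_mul := fun g g' _ _ _ h h' => sumMap_trans (E.act_mul g g' h h') (F.act_mul g g' h h')
  act_J := fun g _ _ _ _ ha hb h h' => sumMap_square (E.act_J g ha hb h h') (F.act_J g ha hb h h')
  act_continuous := fun a b => continuous_sumMap (E.act_continuous a b) (F.act_continuous a b)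

/-- The tensor product. -/
noncomputable def tensor (E F : HilbertNetGBundle G K) : HilbertNetGBundle G K where
  toHilbertNetBundle := E.toHilbertNetBundle.tensor F.toHilbertNetBundle
  act := fun g _ _ h => tensMap (E.act g h) (F.act g h)
  act_one := fun a => tensMap_id (E.act_one a) (F.act_one a)
  act_mul := fun g g' _ _ _ h h' => tensMap_trans (E.act_mul g g' h h') (F.act_mul g g' h h')
  act_J := fun g _ _ _ _ ha hb h h' =>
    tensMap_square (E.act_J g ha hb h h') (F.act_J g ha hb h h')
  act_continuous := fun a b => continuous_tensMap (E.act_continuous a b) (F.act_continuous a b)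

instance setoid : Setoid (HilbertNetGBundle G K) where
  r := Isomorphic
  iseqv :=
    { refl := fun E => ⟨fun _ => LinearEquiv.refl ℂ _, fun _ _ _ _ => rfl, fun _ _ _ _ _ => rfl⟩
      symm := fun ⟨T, hT, hT'⟩ => ⟨fun a => (T a).symm, fun a b h v => by
        rw [LinearEquiv.symm_apply_eq, hT, LinearEquiv.apply_symm_apply], fun g a b h v => by
        rw [LinearEquiv.symm_apply_eq, hT', LinearEquiv.apply_symm_apply]⟩
      trans := fun ⟨T, hT, hT'⟩ ⟨S, hS, hS'⟩ => ⟨fun a => (T a).trans (S a), fun a b h v => by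
        simp only [LinearEquiv.trans_apply, hT, hS], fun g a b h v => by
        simp only [LinearEquiv.trans_apply, hT', hS']⟩ }

/-- A Hilbert net bundle as a Hilbert net `G`-bundle with trivial action, for `G` acting trivially
on `K`. (If `g • a = b` then `a = b`, and `J : fib a → fib b` is the identity.) -/
noncomputable def ofTrivial (htriv : ∀ (g : G) (a : K), g • a = a) (E : HilbertNetBundle K) :
    HilbertNetGBundle G K where
  toHilbertNetBundle := E
  act := fun g a b h => E.J (le_of_eq ((htriv g a).symm.trans h))
  act_one := E.J_refl
  act_mul := fun _ _ _ _ _ _ _ _ => E.J_trans _ _ _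
  act_J := fun _ _ _ _ _ _ _ _ _ _ => by rw [E.J_trans, E.J_trans]
  act_continuous := fun _ _ _ => continuous_of_const fun _ _ => rfl

/-- The fibre over `a` of `B(E, F)_G`, for `G` acting trivially on `K`: the `G`-equivariant linear
maps from `E.fib a` to `F.fib a`. -/
def equivariantMaps (htriv : ∀ (g : G) (a : K), g • a = a) (E F : HilbertNetGBundle G K) (a : K) :
    Submodule ℂ (E.fib a →ₗ[ℂ] F.fib a) where
  carrier := {t | ∀ (g : G) (v : E.fib a),
    t (E.act g (htriv g a) v) = F.act g (htriv g a) (t v)}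
  add_mem' := fun hs ht g v => by
    simp only [LinearMap.add_apply, map_add, hs g v, ht g v]
  zero_mem' := fun g v => by simp
  smul_mem' := fun r t ht g v => by
    simp only [LinearMap.smul_apply, map_smul, ht g v]

theorem conj_mem (htriv : ∀ (g : G) (a : K), g • a = a) (E F : HilbertNetGBundle G K) {a b : K}
    (h : a ≤ b) (t : E.fib a →ₗ[ℂ] F.fib a) (ht : t ∈ equivariantMaps htriv E F a) :
    (F.J h).toLinearEquiv.toLinearMap ∘ₗ t ∘ₗ (E.J h).symm.toLinearEquiv.toLinearMap
      ∈ equivariantMaps htriv E F b := fun g v => by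
  have hE : (E.J h).symm (E.act g (htriv g b) v) = E.act g (htriv g a) ((E.J h).symm v) := by
    rw [LinearIsometryEquiv.symm_apply_eq, ← E.act_J g (htriv g a) (htriv g b) h h,
      LinearIsometryEquiv.apply_symm_apply]
  change F.J h (t ((E.J h).symm (E.act g (htriv g b) v)))
    = F.act g (htriv g b) (F.J h (t ((E.J h).symm v)))
  rw [hE, ht g, F.act_J g (htriv g a) (htriv g b) h h]

theorem conj_symm_mem (htriv : ∀ (g : G) (a : K), g • a = a) (E F : HilbertNetGBundle G K)
    {a b : K} (h : a ≤ b) (t : E.fib b →ₗ[ℂ] F.fib b) (ht : t ∈ equivariantMaps htriv E F b) :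
    (F.J h).symm.toLinearEquiv.toLinearMap ∘ₗ t ∘ₗ (E.J h).toLinearEquiv.toLinearMap
      ∈ equivariantMaps htriv E F a := fun g v => by
  change (F.J h).symm (t (E.J h (E.act g (htriv g a) v)))
    = F.act g (htriv g a) ((F.J h).symm (t (E.J h v)))
  rw [LinearIsometryEquiv.symm_apply_eq, ← E.act_J g (htriv g a) (htriv g b) h h, ht g,
    ← F.act_J g (htriv g a) (htriv g b) h h, LinearIsometryEquiv.apply_symm_apply]

/-- The Hilbert net bundle `B(E, F)_G` of `G`-equivariant linear maps, for `G` acting trivially on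
`K`: the scalar product is the Hilbert–Schmidt one and the net structure is `t ↦ J t J⁻¹`. -/
noncomputable def homBundle (htriv : ∀ (g : G) (a : K), g • a = a)
    (E F : HilbertNetGBundle G K) : HilbertNetBundle K where
  fib := fun a => equivariantMaps htriv E F a
  grp := fun a => hsNormed (equivariantMaps htriv E F a)
  ips := fun a => hsInner (equivariantMaps htriv E F a)
  fin := fun a => inferInstanceAs (FiniteDimensional ℂ (equivariantMaps htriv E F a))
  J := fun {a b} h => hsConj _ _ (E.J h) (F.J h) (conj_mem htriv E F h) (conj_symm_mem htriv E F h)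
  J_refl := fun a t => by
    have hE : ∀ v, (E.J (le_refl a)).symm v = v := fun v => by
      rw [LinearIsometryEquiv.symm_apply_eq, E.J_refl]
    apply Subtype.ext
    ext v
    change F.J (le_refl a) (t.1 ((E.J (le_refl a)).symm v)) = t.1 v
    rw [hE, F.J_refl]
  J_trans := fun {a b c} h h' t => by
    have hE : ∀ v, (E.J h).symm ((E.J h').symm v) = (E.J (h.trans h')).symm v := fun v => by
      rw [LinearIsometryEquiv.symm_apply_eq, LinearIsometryEquiv.symm_apply_eq, E.J_trans,
        LinearIsometryEquiv.apply_symm_apply]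
    apply Subtype.ext
    ext v
    change F.J h' (F.J h (t.1 ((E.J h).symm ((E.J h').symm v))))
      = F.J (h.trans h') (t.1 ((E.J (h.trans h')).symm v))
    rw [hE, F.J_trans]

end HilbertNetGBundle

/-- The semiring of isomorphism classes of Hilbert net `G`-bundles over `K`. -/
def VNetG (G : Type v) [Group G] [TopologicalSpace G] (K : Type u) [PartialOrder K]
    [MulAction G K] : Type (max 1 u v) :=
  Quotient (HilbertNetGBundle.setoid (G := G) (K := K))

namespace VNetG

variable {G : Type v} [Group G] [TopologicalSpace G]
  {K : Type u} [PartialOrder K] [MulAction G K]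

/-- The isomorphism class `{E}`. -/
def mk (E : HilbertNetGBundle G K) : VNetG G K := Quotient.mk _ E

noncomputable instance : Zero (VNetG G K) := ⟨mk HilbertNetGBundle.zero⟩

noncomputable instance : One (VNetG G K) := ⟨mk HilbertNetGBundle.unit⟩

noncomputable instance : Add (VNetG G K) :=
  ⟨Quotient.map₂ HilbertNetGBundle.sum fun _ _ ⟨T, hT, hT'⟩ _ _ ⟨S, hS, hS'⟩ =>
    ⟨fun a => sumCongr (T a) (S a), fun a b h => sumCongr_nat (hT a b h) (hS a b h),
      fun g a b h => sumCongr_nat (hT' g a b h) (hS' g a b h)⟩⟩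

noncomputable instance : Mul (VNetG G K) :=
  ⟨Quotient.map₂ HilbertNetGBundle.tensor fun _ _ ⟨T, hT, hT'⟩ _ _ ⟨S, hS, hS'⟩ =>
    ⟨fun a => TensorProduct.congr (T a) (S a), fun a b h => congr_nat (hT a b h) (hS a b h),
      fun g a b h => congr_nat (hT' g a b h) (hS' g a b h)⟩⟩

noncomputable instance : CommSemiring (VNetG G K) :=
  commSemiringOf (VNetG G K)
    (by
      rintro ⟨E⟩ ⟨F⟩ ⟨H⟩
      exact Quotient.sound ⟨fun _ => (LinearIsometryEquiv.withLpProdAssoc 2 ℂ _ _ _).toLinearEquiv,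
        fun _ _ _ _ => rfl, fun _ _ _ _ _ => rfl⟩)
    (by
      rintro ⟨E⟩
      exact Quotient.sound ⟨fun _ => zeroSum _, fun _ _ _ _ => rfl, fun _ _ _ _ _ => rfl⟩)
    (by
      rintro ⟨E⟩ ⟨F⟩
      exact Quotient.sound ⟨fun _ => (LinearIsometryEquiv.withLpProdComm 2 ℂ _ _).toLinearEquiv,
        fun _ _ _ _ => rfl, fun _ _ _ _ _ => rfl⟩)
    (by
      rintro ⟨E⟩ ⟨F⟩ ⟨H⟩
      exact Quotient.sound ⟨fun _ => (TensorProduct.assocIsometry ℂ _ _ _).toLinearEquiv,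
        fun _ _ _ => assoc_nat _ _ _, fun _ _ _ _ => assoc_nat _ _ _⟩)
    (by
      rintro ⟨E⟩
      exact Quotient.sound ⟨fun _ => (TensorProduct.lidIsometry ℂ _).toLinearEquiv,
        fun _ _ _ => lid_nat _, fun _ _ _ _ => lid_nat _⟩)
    (by
      rintro ⟨E⟩ ⟨F⟩
      exact Quotient.sound ⟨fun _ => (TensorProduct.commIsometry ℂ _ _).toLinearEquiv,
        fun _ _ _ => comm_nat _ _, fun _ _ _ _ => comm_nat _ _⟩)
    (by
      rintro ⟨E⟩
      exact Quotient.sound ⟨fun _ => zeroTens _,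
        fun _ _ _ _ => Subsingleton.elim (α := EuclideanSpace ℂ (Fin 0)) _ _,
        fun _ _ _ _ _ => Subsingleton.elim (α := EuclideanSpace ℂ (Fin 0)) _ _⟩)
    (by
      rintro ⟨E⟩ ⟨F⟩ ⟨H⟩
      exact Quotient.sound ⟨fun _ => distrib _ _ _, fun _ _ _ => distrib_nat _ _ _,
        fun _ _ _ _ => distrib_nat _ _ _⟩)

end VNetG

/-- The equivariant K-theory `K⁰_G(K)`: the Grothendieck ring of the semiring of isomorphism
classes of Hilbert net `G`-bundles over `K`. -/
abbrev K0G (G : Type v) [Group G] [TopologicalSpace G] (K : Type u) [PartialOrder K]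
    [MulAction G K] : Type (max 1 u v) :=
  GrothendieckRing (VNetG G K)

/-- The class `[E] ∈ K⁰_G(K)`. -/
noncomputable def HilbertNetGBundle.cls {G : Type v} [Group G] [TopologicalSpace G]
    {K : Type u} [PartialOrder K] [MulAction G K] (E : HilbertNetGBundle G K) : K0G G K :=
  GrothendieckRing.of (VNetG.mk E)

/-! Since `G` fixes every point of `K`, each fibre of a Hilbert net `G`-bundle is a unitary
representation and the net structure consists of equivariant unitaries. The classical isotypic
decomposition can therefore be made fibre by fibre, and the evaluation `v ⊗ t ↦ t v` from the sum of
the `H_i ⊗ Hom_G(H_i, E_a)` to `E_a` is compatible with both structures. It is injective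
(`piEval_injective`): by Schur, an irreducible subspace of the kernel consists of the vectors `v ⊗
m` in one summand, with `m` fixed, and evaluation kills them all only if `m = 0`. It is surjective
(`piEval_surjective`): an irreducible subspace orthogonal to the image would itself be the image of
an equivariant map that has been counted. Injectivity and dimension bound the number of irreducibles
occurring in one fibre, and connectedness of `K` carries the same finite set to all fibres. This
gives `mk_eq_sum_isotypic`.

The map `Φ` is a product of two ring homomorphisms into a commutative ring, so only bijectivity is
at stake. Surjectivity is the isotypic decomposition. For injectivity there is an additive left
inverse, `isotypicHom`: the functor `B(T_H, -)_G` is additive, and by Schur it sends `T_{H'} ⊗ E` to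
`E` or to `0` according to whether the irreducibles `H`, `H'` are equivalent (`homCls_tensor_self`,
`homCls_tensor_of_mk_ne`). That settles the elements `[E] ⊗ [H]` with `H` irreducible, and these
generate the tensor product by `mk_mem_closure_irreducible`. -/

/-! ### Complete reducibility and Schur's lemma for unitary representations -/

namespace UnitaryRep

variable {G : Type v} [Group G] [TopologicalSpace G]

/-- A subspace is invariant if it is mapped into itself by all group elements. -/
def IsInvariant (H : UnitaryRep G) (W : Submodule ℂ H.V) : Prop :=
  ∀ g, ∀ v ∈ W, H.ρ g v ∈ W

theorem ρ_inv_apply_ρ (H : UnitaryRep G) (g : G) (v : H.V) : H.ρ g⁻¹ (H.ρ g v) = v := by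
  rw [H.map_mul, inv_mul_cancel, H.map_one]

theorem ρ_apply_ρ_inv (H : UnitaryRep G) (g : G) (v : H.V) : H.ρ g (H.ρ g⁻¹ v) = v := by
  rw [H.map_mul, mul_inv_cancel, H.map_one]

/-- Unitarity: the inner product of `w` with `ρ g v` equals that of `ρ g⁻¹ w` with `v`, and `ρ g⁻¹
w` stays in `W`. -/
theorem IsInvariant.orthogonal {H : UnitaryRep G} {W : Submodule ℂ H.V} (hW : H.IsInvariant W) :
    H.IsInvariant Wᗮ := fun g v hv => by
  rw [Submodule.mem_orthogonal] at hv ⊢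
  intro w hw
  rw [← H.ρ_apply_ρ_inv g w, LinearIsometryEquiv.inner_map_map]
  exact hv _ (hW _ _ hw)

/-- The restriction of a representation to an invariant subspace. -/
noncomputable def restrict (H : UnitaryRep G) (W : Submodule ℂ H.V) (hW : H.IsInvariant W) :
    UnitaryRep G where
  V := W
  ρ := fun g =>
    { toFun := fun v => ⟨H.ρ g v, hW g v v.2⟩
      invFun := fun v => ⟨H.ρ g⁻¹ v, hW g⁻¹ v v.2⟩
      map_add' := fun v w => by ext; simp
      map_smul' := fun r v => by ext; simp
      left_inv := fun v => Subtype.ext (H.ρ_inv_apply_ρ g v)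
      right_inv := fun v => Subtype.ext (H.ρ_apply_ρ_inv g v)
      norm_map' := fun v => (H.ρ g).norm_map v }
  map_one := fun v => Subtype.ext (H.map_one v)
  map_mul := fun g h v => Subtype.ext (H.map_mul g h v)
  continuous := fun v => (H.continuous v).subtype_mk _

/-- Every non-zero invariant subspace contains an irreducible one. -/
theorem exists_isIrreducible_restrict (H : UnitaryRep G) {W : Submodule ℂ H.V}
    (hW : H.IsInvariant W) (h0 : W ≠ ⊥) :
    ∃ U ≤ W, ∃ hU : H.IsInvariant U, (H.restrict U hU).IsIrreducible := by
  -- A minimal non-zero invariant subspace of `W`; it exists because the strict order on subspaces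
  -- of a finite-dimensional space is well-founded.
  obtain ⟨U, ⟨hUW, hU, hU0⟩, hmin⟩ := WellFounded.has_min
    (wellFounded_lt (α := Submodule ℂ H.V)) {U | U ≤ W ∧ H.IsInvariant U ∧ U ≠ ⊥}
    ⟨W, le_rfl, hW, h0⟩
  refine ⟨U, hUW, hU, (Submodule.nontrivial_iff_ne_bot (p := U)).2 hU0, ?_⟩
  intro (X : Submodule ℂ U) hX
  by_contra! h
  have hle : X.map U.subtype ≤ U := Submodule.map_subtype_le U X
  have hX' : X.map U.subtype ≠ ⊥ := fun h' => h.1 (by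
    exact Submodule.map_injective_of_injective U.injective_subtype
      (h'.trans (Submodule.map_bot _).symm))
  -- A proper non-zero invariant subspace of `U`, seen inside the whole space, would contradict
  -- minimality.
  refine hmin (X.map U.subtype) ⟨hle.trans hUW, ?_, hX'⟩ (lt_of_le_of_ne hle ?_)
  · rintro g _ ⟨v, hv, rfl⟩
    exact ⟨_, hX g v hv, rfl⟩
  · intro h'
    apply h.2
    apply Submodule.map_injective_of_injective U.injective_subtype
    exact h'.trans (Submodule.map_subtype_top U).symm

theorem mk_eq_restrict_add (H : UnitaryRep G) {W : Submodule ℂ H.V} (hW : H.IsInvariant W) :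
    RepClass.mk H = RepClass.mk (H.restrict W hW) + RepClass.mk (H.restrict Wᗮ hW.orthogonal) := by
  symm
  refine Quotient.sound ⟨(WithLp.linearEquiv 2 ℂ (W × Wᗮ)).trans
    (Submodule.prodEquivOfIsCompl W Wᗮ (Submodule.isCompl_orthogonal W)),
    fun g v => ?_⟩
  exact ((H.ρ g).map_add _ _).symm

theorem mk_eq_zero (H : UnitaryRep G) [Subsingleton H.V] : RepClass.mk H = 0 :=
  Quotient.sound ⟨LinearEquiv.ofSubsingleton _ (EuclideanSpace ℂ (Fin 0)),
    fun _ _ => Subsingleton.elim (α := EuclideanSpace ℂ (Fin 0)) _ _⟩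

/-- The semiring of equivalence classes is additively generated by the irreducible ones. -/
theorem mk_mem_closure_irreducible (H : UnitaryRep G) :
    RepClass.mk H ∈ AddSubmonoid.closure
      {c : RepClass G | ∃ H : UnitaryRep G, H.IsIrreducible ∧ RepClass.mk H = c} := by
  induction hn : Module.finrank ℂ H.V using Nat.strong_induction_on generalizing H with
  | _ n ih =>
    rcases subsingleton_or_nontrivial H.V with h | h
    · rw [mk_eq_zero]
      exact zero_mem _
    -- Split off one irreducible subspace; its complement has smaller dimension because an
    -- irreducible is non-zero.
    · obtain ⟨U, -, hU, hirr⟩ := H.exists_isIrreducible_restrict (W := ⊤)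
        (fun _ _ _ => Submodule.mem_top) top_ne_bot
      rw [H.mk_eq_restrict_add hU]
      refine add_mem (AddSubmonoid.subset_closure ⟨_, hirr, rfl⟩) (ih _ ?_ _ rfl)
      have h1 := Submodule.finrank_add_finrank_orthogonal U
      have h2 : 0 < Module.finrank ℂ U := by
        have : Nontrivial U := hirr.1
        exact Module.finrank_pos
      change Module.finrank ℂ Uᗮ < n
      omega

/-- Invariant subspaces pull back along an equivalence. This is needed because an element of `Irr G`
only promises some irreducible representative, while the chosen one may be another. -/
theorem IsIrreducible.of_mk_eq {H H' : UnitaryRep G} (hH : H.IsIrreducible)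
    (h : RepClass.mk H = RepClass.mk H') : H'.IsIrreducible := by
  obtain ⟨T, hT⟩ : H.Isomorphic H' := Quotient.exact h
  have := hH.1
  refine ⟨T.symm.toEquiv.nontrivial, fun W hW => ?_⟩
  have hW' := hH.2 (W.comap T.toLinearMap) fun g v hv => by
    rw [Submodule.mem_comap] at hv ⊢
    change T _ ∈ W
    rw [hT]
    exact hW g _ hv
  have hmap : (W.comap T.toLinearMap).map T.toLinearMap = W :=
    Submodule.map_comap_eq_of_surjective T.surjective W
  rcases hW' with h | h
  · left
    rw [← hmap, h, Submodule.map_bot]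
  · right
    rw [← hmap, h, Submodule.map_top, LinearMap.range_eq_top]
    exact T.surjective

/-- Schur's lemma: a non-zero equivariant map between irreducible representations is an
isomorphism. -/
theorem IsIrreducible.mk_eq_of_ne_zero {H H' : UnitaryRep G} (hH : H.IsIrreducible)
    (hH' : H'.IsIrreducible) (f : H.V →ₗ[ℂ] H'.V) (hf : ∀ g v, f (H.ρ g v) = H'.ρ g (f v))
    (h0 : f ≠ 0) : RepClass.mk H = RepClass.mk H' := by
  have hker : LinearMap.ker f = ⊥ := by
    refine (hH.2 (LinearMap.ker f) fun g v hv => ?_).resolve_right fun h =>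
      h0 (LinearMap.ker_eq_top.1 h)
    rw [LinearMap.mem_ker] at hv ⊢
    rw [hf, hv, map_zero]
  have hran : LinearMap.range f = ⊤ := by
    refine (hH'.2 (LinearMap.range f) ?_).resolve_left fun h =>
      h0 (LinearMap.range_eq_bot.1 h)
    rintro g _ ⟨v, rfl⟩
    exact ⟨H.ρ g v, hf g v⟩
  exact Quotient.sound ⟨LinearEquiv.ofBijective f
    ⟨LinearMap.ker_eq_bot.1 hker, LinearMap.range_eq_top.1 hran⟩, hf⟩

/-- Schur's lemma: an equivariant endomorphism of an irreducible representation is scalar. -/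
theorem IsIrreducible.exists_smul {H : UnitaryRep G} (hH : H.IsIrreducible)
    (f : H.V →ₗ[ℂ] H.V) (hf : ∀ g v, f (H.ρ g v) = H.ρ g (f v)) :
    ∃ r : ℂ, ∀ v, f v = r • v := by
  have := hH.1
  obtain ⟨r, hr⟩ := Module.End.exists_eigenvalue (K := ℂ) f
  refine ⟨r, fun v => ?_⟩
  -- The eigenspace is invariant and non-zero, hence everything.
  have htop := (hH.2 (Module.End.eigenspace f r) fun g v hv => by
    rw [Module.End.mem_eigenspace_iff] at hv ⊢
    rw [hf, hv, map_smul]).resolve_left hr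
  exact Module.End.mem_eigenspace_iff.1 (htop ▸ Submodule.mem_top)

/-! ### Equivariant maps into `H ⊗ M`, with `G` acting on the first factor only -/

section Tensor

variable {V M : Type*} [AddCommGroup V] [Module ℂ V] [AddCommGroup M] [Module ℂ M]

/-- The contraction `v ⊗ m ↦ φ m • v` of a tensor with a linear form. -/
noncomputable def contract (V : Type*) [AddCommGroup V] [Module ℂ V] (φ : M →ₗ[ℂ] ℂ) :
    V ⊗[ℂ] M →ₗ[ℂ] V :=
  (TensorProduct.rid ℂ V).toLinearMap ∘ₗ LinearMap.lTensor V φ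

theorem contract_tmul (φ : M →ₗ[ℂ] ℂ) (v : V) (m : M) : contract V φ (v ⊗ₜ m) = φ m • v := by
  simp [contract]

/-- Contraction touches only the factor `M`, so it commutes with operators on `V`; contracting an
equivariant map therefore leaves it equivariant. -/
theorem contract_rTensor (φ : M →ₗ[ℂ] ℂ) (f : V →ₗ[ℂ] V) (x : V ⊗[ℂ] M) :
    contract V φ (f.rTensor M x) = f (contract V φ x) := by
  induction x with
  | zero => simp
  | add x y hx hy => simp only [map_add, hx, hy]
  | tmul v m => simp [contract_tmul]

/-- The expansion along a basis of `M`. It reduces questions on maps into `V ⊗ M` to their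
coordinates, which are maps into `V`. -/
theorem sum_contract_tmul {ι : Type*} [Fintype ι] (b : Module.Basis ι ℂ M) (x : V ⊗[ℂ] M) :
    ∑ i, contract V (b.coord i) x ⊗ₜ[ℂ] b i = x := by
  induction x with
  | zero => simp
  | add x y hx hy => simp only [map_add, TensorProduct.add_tmul, Finset.sum_add_distrib, hx, hy]
  | tmul v m =>
    simp only [contract_tmul, TensorProduct.smul_tmul, ← TensorProduct.tmul_sum]
    congr 1
    exact b.sum_repr m

theorem IsIrreducible.eq_zero_of_tmul_eq_zero {H : UnitaryRep G} (hH : H.IsIrreducible) {m : M}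
    (h : ∀ v : H.V, v ⊗ₜ[ℂ] m = 0) : m = 0 := by
  have := hH.1
  obtain ⟨v, hv⟩ := exists_ne (0 : H.V)
  -- Pairing the first factor with `v` turns `v ⊗ m = 0` into `‖v‖² • m = 0`.
  have h' := congrArg (fun x => TensorProduct.lid ℂ M (LinearMap.rTensor M (innerₛₗ ℂ v) x)) (h v)
  simpa [hv] using h'

variable [FiniteDimensional ℂ M]

/-- Each coordinate of `t` along a basis of `M` is an equivariant map between inequivalent
irreducibles, so Schur's lemma kills it. -/
theorem IsIrreducible.eq_zero_of_mk_ne {H H' : UnitaryRep G} (hH : H.IsIrreducible)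
    (hH' : H'.IsIrreducible) (hne : RepClass.mk H ≠ RepClass.mk H')
    (t : H.V →ₗ[ℂ] H'.V ⊗[ℂ] M)
    (ht : ∀ g v, t (H.ρ g v)
      = LinearMap.rTensor M (H'.ρ g).toLinearEquiv.toLinearMap (t v)) : t = 0 := by
  ext v
  rw [← sum_contract_tmul (Module.finBasis ℂ M) (t v)]
  refine Finset.sum_eq_zero fun i _ => ?_
  have : contract H'.V ((Module.finBasis ℂ M).coord i) ∘ₗ t = 0 := by
    by_contra h0
    refine hne (hH.mk_eq_of_ne_zero hH' _ (fun g v => ?_) h0)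
    rw [LinearMap.comp_apply, ht, contract_rTensor]
    rfl
  have h := LinearMap.congr_fun this v
  rw [LinearMap.comp_apply] at h
  rw [h, LinearMap.zero_apply, TensorProduct.zero_tmul]

/-- Each coordinate of `t` is an equivariant endomorphism of `H`, hence a scalar `r i`; these
scalars are the coordinates of `m`. -/
theorem IsIrreducible.exists_tmul {H : UnitaryRep G} (hH : H.IsIrreducible)
    (t : H.V →ₗ[ℂ] H.V ⊗[ℂ] M)
    (ht : ∀ g v, t (H.ρ g v)
      = LinearMap.rTensor M (H.ρ g).toLinearEquiv.toLinearMap (t v)) :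
    ∃ m : M, ∀ v, t v = v ⊗ₜ m := by
  have h (i) := hH.exists_smul (contract H.V ((Module.finBasis ℂ M).coord i) ∘ₗ t) fun g v => by
    rw [LinearMap.comp_apply, ht, contract_rTensor]
    rfl
  choose r hr using h
  refine ⟨∑ i, r i • Module.finBasis ℂ M i, fun v => ?_⟩
  rw [← sum_contract_tmul (Module.finBasis ℂ M) (t v), TensorProduct.tmul_sum]
  refine Finset.sum_congr rfl fun i _ => ?_
  have := hr i v
  rw [LinearMap.comp_apply] at this
  rw [this, TensorProduct.smul_tmul]

end Tensor

end UnitaryRep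

/-! ### The ring homomorphism `Φ` -/

namespace GrothendieckRing

variable {S T : Type*} [CommSemiring S] [CommSemiring T]

/-- The ring homomorphism induced by a homomorphism of semirings. -/
noncomputable def map (f : S →+* T) : GrothendieckRing S →+* GrothendieckRing T where
  __ := lift ((of (S := T)).comp f.toAddMonoidHom)
  map_one' := by
    change lift ((of (S := T)).comp f.toAddMonoidHom) (of 1) = of 1
    simp [lift_of]
  map_mul' := fun x y => by
    obtain ⟨x, x', rfl⟩ := exists_sub x
    obtain ⟨y, y', rfl⟩ := exists_sub y
    change lift ((of (S := T)).comp f.toAddMonoidHom) _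
      = lift ((of (S := T)).comp f.toAddMonoidHom) _ * lift ((of (S := T)).comp f.toAddMonoidHom) _
    simp only [mul_sub, sub_mul, of_mul_of, map_sub, lift_of]
    simp only [AddMonoidHom.comp_apply, RingHom.toAddMonoidHom_eq_coe, AddMonoidHom.coe_coe,
      map_mul, of_mul_of]

theorem map_of (f : S →+* T) (x : S) : map f (of x) = of (f x) :=
  lift_of _ x

theorem addHom_ext {A : Type*} [AddCommGroup A] {f g : GrothendieckRing S →+ A}
    (h : ∀ x, f (of x) = g (of x)) : f = g := by
  ext z
  obtain ⟨x, y, rfl⟩ := exists_sub z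
  rw [map_sub, map_sub, h, h]

end GrothendieckRing

section

variable {G : Type v} [Group G] [TopologicalSpace G] {K : Type u} [PartialOrder K] [MulAction G K]

/-- The semiring homomorphism which gives net bundles the trivial action. -/
noncomputable def VNet.ofTrivialHom (htriv : ∀ (g : G) (a : K), g • a = a) :
    VNet K →+* VNetG G K where
  toFun := Quotient.map (HilbertNetGBundle.ofTrivial htriv) fun _ _ ⟨T, hT⟩ =>
    ⟨T, hT, fun _ _ _ _ _ => hT _ _ _ _⟩
  map_zero' := Quotient.sound ⟨fun _ => LinearEquiv.refl ℂ _, fun _ _ _ _ => rfl,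
    fun _ _ _ _ _ => rfl⟩
  map_one' := Quotient.sound ⟨fun _ => LinearEquiv.refl ℂ _, fun _ _ _ _ => rfl,
    fun _ _ _ _ _ => rfl⟩
  map_add' := by
    rintro ⟨E⟩ ⟨F⟩
    exact Quotient.sound ⟨fun _ => LinearEquiv.refl ℂ _, fun _ _ _ _ => rfl,
      fun _ _ _ _ _ => rfl⟩
  map_mul' := by
    rintro ⟨E⟩ ⟨F⟩
    exact Quotient.sound ⟨fun _ => LinearEquiv.refl ℂ _, fun _ _ _ _ => rfl,
      fun _ _ _ _ _ => rfl⟩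

variable (K) in
/-- The semiring homomorphism `[H] ↦ [T_H]`. -/
noncomputable def RepClass.bundleHom : RepClass G →+* VNetG G K where
  toFun := Quotient.map (HilbertNetGBundle.ofRep K) fun _ _ ⟨T, hT⟩ =>
    ⟨fun _ => T, fun _ _ _ _ => rfl, fun g _ _ _ v => hT g v⟩
  map_zero' := Quotient.sound ⟨fun _ => LinearEquiv.refl ℂ _, fun _ _ _ _ => rfl,
    fun _ _ _ _ _ => rfl⟩
  map_one' := rfl
  map_add' := by
    rintro ⟨E⟩ ⟨F⟩
    exact Quotient.sound ⟨fun _ => LinearEquiv.refl ℂ _, fun _ _ _ _ => rfl,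
      fun _ _ _ _ _ => rfl⟩
  map_mul' := by
    rintro ⟨E⟩ ⟨F⟩
    refine Quotient.sound ⟨fun _ => LinearEquiv.refl ℂ _, fun _ _ _ v => ?_,
      fun _ _ _ _ _ => rfl⟩
    -- The net structure of `T_H ⊗ T_{H'}` is `id ⊗ id`, which equals the identity by a lemma and
    -- not by definition.
    exact (tensMap_id (fun _ => rfl) (fun _ => rfl) v).symm

/-- The homomorphism `[E] ⊗ [H] ↦ [T_H ⊗ E]`. -/
noncomputable def tensorToK0G (htriv : ∀ (g : G) (a : K), g • a = a) :
    K0 K ⊗[ℤ] RepRing G →ₐ[ℤ] K0G G K :=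
  Algebra.TensorProduct.productMap
    (GrothendieckRing.map (VNet.ofTrivialHom htriv)).toIntAlgHom
    (GrothendieckRing.map (RepClass.bundleHom K)).toIntAlgHom

theorem tensorToK0G_tmul (htriv : ∀ (g : G) (a : K), g • a = a) (E : HilbertNetBundle K)
    (H : UnitaryRep G) : tensorToK0G htriv (E.cls ⊗ₜ[ℤ] H.cls) =
      ((HilbertNetGBundle.ofRep K H).tensor (HilbertNetGBundle.ofTrivial htriv E)).cls := by
  -- The product map places the factor of `E` first, the bundle `T_H ⊗ E` places it second.
  rw [tensorToK0G, Algebra.TensorProduct.productMap_apply_tmul, mul_comm]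
  change GrothendieckRing.map _ (GrothendieckRing.of _) * GrothendieckRing.map _
    (GrothendieckRing.of _) = _
  rw [GrothendieckRing.map_of, GrothendieckRing.map_of, GrothendieckRing.of_mul_of]
  rfl

/-! ### Finite direct sums and fibres of `G`-bundles -/

namespace HilbertNetGBundle

/-- The direct sum of a finite sequence of bundles. -/
noncomputable def pi {n : ℕ} (E : Fin n → HilbertNetGBundle G K) : HilbertNetGBundle G K where
  fib := fun a => PiLp 2 fun i => (E i).fib a
  J := fun h => LinearIsometryEquiv.piLpCongrRight 2 fun i => (E i).J h
  J_refl := fun a v => by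
    ext i
    exact (E i).J_refl a (v i)
  J_trans := fun h h' v => by
    ext i
    exact (E i).J_trans h h' (v i)
  act := fun g _ _ h => LinearIsometryEquiv.piLpCongrRight 2 fun i => (E i).act g h
  act_one := fun a v => by
    ext i
    exact (E i).act_one a (v i)
  act_mul := fun g g' _ _ _ h h' v => by
    ext i
    exact (E i).act_mul g g' h h' (v i)
  act_J := fun g _ _ _ _ ha hb h h' v => by
    ext i
    exact (E i).act_J g ha hb h h' (v i)
  act_continuous := fun a b v =>
    (PiLp.continuous_toLp 2 _).comp (continuous_pi fun i => (E i).act_continuous a b (v i))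

theorem mk_eq_zero (E : HilbertNetGBundle G K) [∀ a, Subsingleton (E.fib a)] :
    VNetG.mk E = 0 :=
  Quotient.sound ⟨fun _ => LinearEquiv.ofSubsingleton _ (EuclideanSpace ℂ (Fin 0)),
    fun _ _ _ _ => Subsingleton.elim (α := EuclideanSpace ℂ (Fin 0)) _ _,
    fun _ _ _ _ _ => Subsingleton.elim (α := EuclideanSpace ℂ (Fin 0)) _ _⟩

theorem mk_pi {n : ℕ} (E : Fin n → HilbertNetGBundle G K) :
    VNetG.mk (pi E) = ∑ i, VNetG.mk (E i) := by
  induction n with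
  | zero =>
    have (a : K) : Subsingleton ((pi E).fib a) :=
      inferInstanceAs (Subsingleton (PiLp 2 fun i => (E i).fib a))
    rw [mk_eq_zero, Fin.sum_univ_zero]
  | succ n ih =>
    rw [Fin.sum_univ_succ, ← ih]
    symm
    -- The isomorphism prepends the component with index `0` to the others.
    refine Quotient.sound ⟨fun a => (WithLp.linearEquiv 2 ℂ
      ((E 0).fib a × PiLp 2 fun i : Fin n => (E i.succ).fib a)).trans
      (((LinearEquiv.refl ℂ _).prodCongr (WithLp.linearEquiv 2 ℂ _)).trans
        ((Fin.consLinearEquiv ℂ fun i => (E i).fib a).trans (WithLp.linearEquiv 2 ℂ _).symm)),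
      fun a b h v => ?_, fun g a b h v => ?_⟩
    · refine PiLp.ext fun i => ?_
      refine Fin.cases ?_ (fun i => ?_) i <;> rfl
    · refine PiLp.ext fun i => ?_
      refine Fin.cases ?_ (fun i => ?_) i <;> rfl

/-- The fibre of a bundle as a representation. -/
noncomputable def fiberRep (htriv : ∀ (g : G) (a : K), g • a = a) (E : HilbertNetGBundle G K)
    (a : K) : UnitaryRep G where
  V := E.fib a
  ρ := fun g => E.act g (htriv g a)
  map_one := E.act_one a
  map_mul := fun g h v => E.act_mul g h (htriv h a) (htriv g a) v
  continuous := fun v => (E.act_continuous a a v).comp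
    (Continuous.subtype_mk continuous_id fun g => htriv g a)

end HilbertNetGBundle
end

/-- Puts the action on `T_H ⊗ E`, for `E` with trivial action, into the form required by the Schur
lemmas for `H ⊗ M`. -/
theorem HilbertNat.tensMap_eq_rTensor {V W M : Type*} [NormedAddCommGroup V]
    [InnerProductSpace ℂ V] [NormedAddCommGroup W] [InnerProductSpace ℂ W]
    [NormedAddCommGroup M] [InnerProductSpace ℂ M] (f : V ≃ₗᵢ[ℂ] W) {g : M ≃ₗᵢ[ℂ] M}
    (hg : ∀ m, g m = m) (x : V ⊗[ℂ] M) :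
    tensMap f g x = LinearMap.rTensor M f.toLinearEquiv.toLinearMap x := by
  induction x with
  | zero => simp
  | add x y hx hy => simp only [map_add, hx, hy]
  | tmul v m => simp [hg]

/-- The fibres of a net bundle over a pathwise connected poset are isomorphic. -/
theorem HilbertNetBundle.nonempty_fib_equiv {K : Type u} [PartialOrder K]
    (hK : PathwiseConnected K) (E : HilbertNetBundle K) (a b : K) :
    Nonempty (E.fib a ≃ E.fib b) := by
  induction hK.2 a b with
  | refl => exact ⟨Equiv.refl _⟩
  | tail _ h ih =>
    obtain ⟨e⟩ := ih
    obtain ⟨o, ho, ho'⟩ := h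
    -- Go up to the common upper bound and down again, using that `J` is invertible.
    exact ⟨(e.trans (E.J ho).toEquiv).trans (E.J ho').toEquiv.symm⟩

namespace HilbertNetGBundle

variable {G : Type v} [Group G] [TopologicalSpace G] {K : Type u} [PartialOrder K] [MulAction G K]

/-- An element of a fibre of `B(E, F)_G` as an equivariant map. -/
noncomputable def homFibEquiv (htriv : ∀ (g : G) (a : K), g • a = a)
    (E F : HilbertNetGBundle G K) (a : K) :
    (homBundle htriv E F).fib a ≃ₗ[ℂ] equivariantMaps htriv E F a where
  toFun := fun t => t
  invFun := fun t => t
  map_add' := fun _ _ => rfl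
  map_smul' := fun _ _ => rfl
  left_inv := fun _ => rfl
  right_inv := fun _ => rfl

theorem homBundle_ext {htriv : ∀ (g : G) (a : K), g • a = a} {E F : HilbertNetGBundle G K}
    {a : K} {s t : (homBundle htriv E F).fib a}
    (h : ∀ v, (homFibEquiv htriv E F a s).1 v = (homFibEquiv htriv E F a t).1 v) : s = t :=
  (homFibEquiv htriv E F a).injective (Subtype.ext (LinearMap.ext h))

/-! ### The evaluation map on isotypic bundles -/

section Isotypic

variable (htriv : ∀ (g : G) (a : K), g • a = a) (E : HilbertNetGBundle G K)

/-- The isotypic bundle `T_H ⊗ B(T_H, E)_G`. -/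
noncomputable abbrev isotypic (H : UnitaryRep G) : HilbertNetGBundle G K :=
  (ofRep K H).tensor (ofTrivial htriv (homBundle htriv (ofRep K H) E))

theorem isotypic_act (H : UnitaryRep G) (a : K) (g : G)
    (x : H.V ⊗[ℂ] (homBundle htriv (ofRep K H) E).fib a) :
    (isotypic htriv E H).act g (htriv g a) x = LinearMap.rTensor
      ((homBundle htriv (ofRep K H) E).fib a) (H.ρ g).toLinearEquiv.toLinearMap x :=
  tensMap_eq_rTensor _ ((homBundle htriv (ofRep K H) E).J_refl a) x

/-- The evaluation `v ⊗ t ↦ t v`. -/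
noncomputable def isotypicEval (H : UnitaryRep G) (a : K) :
    H.V ⊗[ℂ] (homBundle htriv (ofRep K H) E).fib a →ₗ[ℂ] E.fib a :=
  TensorProduct.lift (LinearMap.flip
    ((equivariantMaps htriv (ofRep K H) E a).subtype
      ∘ₗ (homFibEquiv htriv (ofRep K H) E a).toLinearMap))

theorem isotypicEval_tmul (H : UnitaryRep G) (a : K) (v : H.V)
    (t : (homBundle htriv (ofRep K H) E).fib a) :
    isotypicEval htriv E H a (v ⊗ₜ t) = (homFibEquiv htriv (ofRep K H) E a t).1 v :=
  rfl

/-- The net structure of `B(T_H, E)_G` sends `t` to `J t J⁻¹`, and the inner `J` is the identity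
because `T_H` is constant. -/
theorem isotypicEval_J (H : UnitaryRep G) {a b : K} (h : a ≤ b)
    (x : H.V ⊗[ℂ] (homBundle htriv (ofRep K H) E).fib a) :
    isotypicEval htriv E H b (tensMap (LinearIsometryEquiv.refl ℂ H.V)
      ((homBundle htriv (ofRep K H) E).J h) x) = E.J h (isotypicEval htriv E H a x) := by
  induction x with
  | zero => simp only [map_zero]
  | add x y hx hy => simp only [map_add, hx, hy]
  | tmul v t => rfl

theorem isotypicEval_rTensor (H : UnitaryRep G) (a : K) (g : G)
    (x : H.V ⊗[ℂ] (homBundle htriv (ofRep K H) E).fib a) :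
    isotypicEval htriv E H a (LinearMap.rTensor _ (H.ρ g).toLinearEquiv.toLinearMap x)
      = E.act g (htriv g a) (isotypicEval htriv E H a x) := by
  induction x with
  | zero => simp only [map_zero]
  | add x y hx hy => simp only [map_add, hx, hy]
  | tmul v t => exact (homFibEquiv htriv (ofRep K H) E a t).2 g v

variable {n : ℕ} (H : Fin n → UnitaryRep G)

/-- The component of an element of a direct sum of isotypic bundles. -/
noncomputable def isotypicProj (a : K) (i : Fin n) :
    (pi fun i => isotypic htriv E (H i)).fib a
      →ₗ[ℂ] (H i).V ⊗[ℂ] (homBundle htriv (ofRep K (H i)) E).fib a where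
  toFun := fun x => (WithLp.ofLp x) i
  map_add' := fun _ _ => rfl
  map_smul' := fun _ _ => rfl

theorem isotypicProj_ext {a : K} {x y : (pi fun i => isotypic htriv E (H i)).fib a}
    (h : ∀ i, isotypicProj htriv E H a i x = isotypicProj htriv E H a i y) : x = y :=
  PiLp.ext h

theorem isotypicProj_act (a : K) (i : Fin n) (g : G)
    (x : (pi fun i => isotypic htriv E (H i)).fib a) :
    isotypicProj htriv E H a i ((pi fun i => isotypic htriv E (H i)).act g (htriv g a) x)
      = LinearMap.rTensor _ ((H i).ρ g).toLinearEquiv.toLinearMap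
        (isotypicProj htriv E H a i x) :=
  isotypic_act htriv E (H i) a g _

/-- The sum of the evaluation maps. -/
noncomputable def piEval (a : K) : (pi fun i => isotypic htriv E (H i)).fib a →ₗ[ℂ] E.fib a :=
  ∑ i, isotypicEval htriv E (H i) a ∘ₗ isotypicProj htriv E H a i

theorem piEval_apply (a : K) (x : (pi fun i => isotypic htriv E (H i)).fib a) :
    piEval htriv E H a x
      = ∑ i, isotypicEval htriv E (H i) a (isotypicProj htriv E H a i x) := by
  simp [piEval]

theorem piEval_J {a b : K} (h : a ≤ b) (x : (pi fun i => isotypic htriv E (H i)).fib a) :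
    piEval htriv E H b ((pi fun i => isotypic htriv E (H i)).J h x)
      = E.J h (piEval htriv E H a x) := by
  rw [piEval_apply, piEval_apply, map_sum]
  exact Finset.sum_congr rfl fun i _ => isotypicEval_J htriv E (H i) h _

theorem piEval_act (a : K) (g : G) (x : (pi fun i => isotypic htriv E (H i)).fib a) :
    piEval htriv E H a ((pi fun i => isotypic htriv E (H i)).act g (htriv g a) x)
      = E.act g (htriv g a) (piEval htriv E H a x) := by
  rw [piEval_apply, piEval_apply, map_sum]
  refine Finset.sum_congr rfl fun i _ => ?_
  rw [isotypicProj_act, isotypicEval_rTensor]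

/-- The kernel is invariant, so if non-zero it contains an irreducible `U`. Some component of `U` is
non-zero, whence `U` is equivalent to `H i`; the `H j` being pairwise inequivalent, all other
components vanish on `U`. The remaining one is `v ⊗ m` with `m` fixed, and lying in the kernel means
`m v = 0` for all `v`. -/
theorem piEval_injective (hH : ∀ i, (H i).IsIrreducible)
    (hinj : Function.Injective fun i => RepClass.mk (H i)) (a : K) :
    Function.Injective (piEval htriv E H a) := by
  rw [← LinearMap.ker_eq_bot]
  by_contra hne
  set D := fiberRep htriv (pi fun i => isotypic htriv E (H i)) a
  obtain ⟨U, hU, hUinv, hirr⟩ := D.exists_isIrreducible_restrict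
    (W := LinearMap.ker (piEval htriv E H a)) (fun g v hv => by
      refine LinearMap.mem_ker.2 ((piEval_act htriv E H a g v).trans ?_)
      exact (congrArg _ (LinearMap.mem_ker.1 hv)).trans (map_zero _)) hne
  let p (i : Fin n) : (D.restrict U hUinv).V →ₗ[ℂ]
    (H i).V ⊗[ℂ] (homBundle htriv (ofRep K (H i)) E).fib a :=
    isotypicProj htriv E H a i ∘ₗ U.subtype
  have hp (i : Fin n) (g : G) (u : (D.restrict U hUinv).V) :
      p i ((D.restrict U hUinv).ρ g u)
        = LinearMap.rTensor _ ((H i).ρ g).toLinearEquiv.toLinearMap (p i u) :=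
    isotypicProj_act htriv E H a i g _
  obtain ⟨i, hi⟩ : ∃ i, p i ≠ 0 := by
    by_contra! h
    have := hirr.1
    obtain ⟨u, hu⟩ := exists_ne (0 : (D.restrict U hUinv).V)
    refine hu (Subtype.ext (isotypicProj_ext htriv E H fun i => ?_))
    exact (LinearMap.congr_fun (h i) u).trans (map_zero _).symm
  have hmk : RepClass.mk (D.restrict U hUinv) = RepClass.mk (H i) := by
    by_contra h
    exact hi (hirr.eq_zero_of_mk_ne (hH i) h (p i) (hp i))
  have hzero (j : Fin n) (hj : j ≠ i) : p j = 0 :=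
    hirr.eq_zero_of_mk_ne (hH j) (fun h => hj (hinj (h.symm.trans hmk))) (p j) (hp j)
  -- Reparametrise `U` by `H i`, so that the `i`-th component becomes an equivariant map from `H i`
  -- to `H i ⊗ M`.
  obtain ⟨T, hT⟩ : (H i).Isomorphic (D.restrict U hUinv) := Quotient.exact hmk.symm
  obtain ⟨m, hm⟩ := (hH i).exists_tmul (p i ∘ₗ T.toLinearMap) fun g v => by
    rw [LinearMap.comp_apply, LinearMap.comp_apply]
    exact (congrArg (p i) (hT g v)).trans (hp i g _)
  have hm0 : m = 0 := by
    refine homBundle_ext fun (v : (H i).V) => ?_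
    have h1 := (piEval_apply htriv E H a _).symm.trans (LinearMap.mem_ker.1 (hU (T v).2))
    rw [Finset.sum_eq_single i] at h1
    · rw [← isotypicEval_tmul, ← hm v, map_zero]
      exact h1
    · intro j _ hj
      exact (congrArg _ (LinearMap.congr_fun (hzero j hj) (T v))).trans (map_zero _)
    · simp
  apply hi
  ext u
  have := hm (T.symm u)
  rw [hm0, TensorProduct.tmul_zero, LinearMap.comp_apply, LinearEquiv.coe_coe,
    LinearEquiv.apply_symm_apply] at this
  exact this

/-- The orthogonal complement of the image is invariant; if non-zero, it contains an irreducible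
`U`. By `hsurj`, `U` is equivalent to some `H i`, and the resulting map from `H i` onto `U` has its
values both in the image and orthogonal to it. -/
theorem piEval_surjective (a : K)
    (hsurj : ∀ S : UnitaryRep G, S.IsIrreducible →
      Nontrivial ((homBundle htriv (ofRep K S) E).fib a) → ∃ i, RepClass.mk S = RepClass.mk (H i)) :
    Function.Surjective (piEval htriv E H a) := by
  rw [← LinearMap.range_eq_top]
  by_contra hne
  have hinv : (fiberRep htriv E a).IsInvariant (LinearMap.range (piEval htriv E H a)) := by
    rintro g _ ⟨x, rfl⟩
    exact ⟨_, piEval_act htriv E H a g x⟩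
  obtain ⟨U, hU, hUinv, hirr⟩ := (fiberRep htriv E a).exists_isIrreducible_restrict
    hinv.orthogonal (fun h => hne ((Submodule.orthogonal_eq_bot_iff
      (K := LinearMap.range (piEval htriv E H a))).1 h))
  have := hirr.1
  -- An equivalence with `U` followed by the inclusion. This serves twice: for `U` itself, to
  -- satisfy the non-vanishing condition in `hsurj`, and then for `H i`.
  have key (S : UnitaryRep G) (hS : S.Isomorphic ((fiberRep htriv E a).restrict U hUinv)) :
      ∃ t : (homBundle htriv (ofRep K S) E).fib a,
        (∀ v, (homFibEquiv htriv (ofRep K S) E a t).1 v ∈ U) ∧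
        ∃ v, (homFibEquiv htriv (ofRep K S) E a t).1 v ≠ 0 := by
    obtain ⟨T, hT⟩ := hS
    refine ⟨(homFibEquiv htriv (ofRep K S) E a).symm ⟨U.subtype ∘ₗ T.toLinearMap,
      fun g v => congrArg Subtype.val (hT g v)⟩, fun v => (T v).2, ?_⟩
    obtain ⟨u, hu⟩ := exists_ne (0 : ((fiberRep htriv E a).restrict U hUinv).V)
    refine ⟨T.symm u, fun h => hu (Subtype.ext ?_)⟩
    have h' : (T (T.symm u)).1 = 0 := h
    rw [LinearEquiv.apply_symm_apply] at h'
    exact h'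
  obtain ⟨i, hi⟩ := hsurj _ hirr (by
    obtain ⟨t, -, v, hv⟩ := key _ (⟨LinearEquiv.refl ℂ _, fun _ _ => rfl⟩)
    refine ⟨t, 0, fun h => hv ?_⟩
    rw [h, map_zero]
    rfl)
  obtain ⟨t, ht, v, hv⟩ := key (H i) (Quotient.exact hi.symm)
  apply hv
  have hmem : (homFibEquiv htriv (ofRep K (H i)) E a t).1 v
      ∈ LinearMap.range (piEval htriv E H a) := by
    classical
    -- The preimage of `t v` is `v ⊗ t` placed in the `i`-th summand.
    refine ⟨WithLp.toLp 2 (Pi.single i (v ⊗ₜ t)), (piEval_apply htriv E H a _).trans ?_⟩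
    rw [Finset.sum_eq_single i]
    · refine (congrArg (isotypicEval htriv E (H i) a) (Pi.single_eq_same i _)).trans ?_
      exact isotypicEval_tmul htriv E (H i) a v t
    · intro j _ hj
      refine (congrArg (isotypicEval htriv E (H j) a) (Pi.single_eq_of_ne hj _)).trans ?_
      exact map_zero _
    · simp
  exact inner_self_eq_zero.1 (Submodule.inner_right_of_mem_orthogonal hmem (hU (ht v)))

/-- The `n` isotypic summands are non-zero and their direct sum embeds in the fibre by
`piEval_injective`. -/
theorem le_finrank_fib (hH : ∀ i, (H i).IsIrreducible)
    (hinj : Function.Injective fun i => RepClass.mk (H i)) (a : K)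
    (hne : ∀ i, Nontrivial ((homBundle htriv (ofRep K (H i)) E).fib a)) :
    n ≤ Module.finrank ℂ (E.fib a) := by
  let e : ((pi fun i => isotypic htriv E (H i)).fib a) ≃ₗ[ℂ]
      (Π i, (H i).V ⊗[ℂ] (homBundle htriv (ofRep K (H i)) E).fib a) :=
    WithLp.linearEquiv 2 ℂ _
  have h1 := LinearMap.finrank_le_finrank_of_injective (piEval_injective htriv E H hH hinj a)
  rw [e.finrank_eq, Module.finrank_pi_fintype] at h1
  refine le_trans ?_ h1
  have h2 : ∀ i ∈ Finset.univ, 1 ≤ Module.finrank ℂ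
      ((H i).V ⊗[ℂ] (homBundle htriv (ofRep K (H i)) E).fib a) := fun i _ => by
    have := (hH i).1
    rw [Module.finrank_tensorProduct]
    exact Nat.mul_pos Module.finrank_pos Module.finrank_pos
  simpa using Finset.card_nsmul_le_sum _ _ _ h2

end Isotypic

end HilbertNetGBundle

section

variable {G : Type v} [Group G] [TopologicalSpace G] {K : Type u} [PartialOrder K] [MulAction G K]

theorem UnitaryRep.isIrreducible_of_mk_eq {H : UnitaryRep G} {c : Irr G}
    (hH : RepClass.mk H = c.1) : H.IsIrreducible := by
  obtain ⟨H', hH', h⟩ := c.2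
  exact hH'.of_mk_eq (h.trans hH.symm)

namespace HilbertNetGBundle

variable (htriv : ∀ (g : G) (a : K), g • a = a)

/-! ### Finiteness and the isotypic decomposition -/

section Decomposition

variable {α : Irr G → UnitaryRep G} (hα : ∀ c, RepClass.mk (α c) = c.1)
  (E : HilbertNetGBundle G K)

include hα in
/-- Only finitely many irreducible representations occur in a fibre. -/
theorem finite_nontrivial_hom (a : K) :
    {c | Nontrivial ((homBundle htriv (ofRep K (α c)) E).fib a)}.Finite := by
  by_contra hinf
  -- One more irreducible than the dimension of the fibre allows.
  obtain ⟨t, ht, hcard⟩ := Set.Infinite.exists_subset_card_eq hinf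
    (Module.finrank ℂ (E.fib a) + 1)
  have := le_finrank_fib htriv E (fun i => α (t.equivFin.symm i).1)
    (fun i => UnitaryRep.isIrreducible_of_mk_eq (hα _))
    (fun i j hij => t.equivFin.symm.injective (Subtype.ext (Subtype.ext
      ((hα _).symm.trans (hij.trans (hα _)))))) a (fun i => ht (t.equivFin.symm i).2)
  omega

include hα in
/-- Over a pathwise connected poset only finitely many irreducible representations occur in a
bundle. -/
theorem exists_finset_subsingleton_hom (hK : PathwiseConnected K) :
    ∃ s : Finset (Irr G), ∀ c ∉ s, ∀ a,
      Subsingleton ((homBundle htriv (ofRep K (α c)) E).fib a) := by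
  obtain ⟨b⟩ := hK.1
  refine ⟨(finite_nontrivial_hom htriv hα E b).toFinset, fun c hc a => ?_⟩
  rw [Set.Finite.mem_toFinset, Set.mem_ofPred_eq, not_nontrivial_iff_subsingleton] at hc
  -- All fibres of this Hom bundle are in bijection, so its vanishing over `b` spreads to every `a`.
  obtain ⟨e⟩ := (homBundle htriv (ofRep K (α c)) E).nonempty_fib_equiv hK a b
  exact e.subsingleton

include hα in
/-- The isotypic decomposition. -/
theorem mk_eq_sum_isotypic {s : Finset (Irr G)}
    (hs : ∀ c ∉ s, ∀ a, Subsingleton ((homBundle htriv (ofRep K (α c)) E).fib a)) :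
    VNetG.mk E = ∑ c ∈ s, VNetG.mk (isotypic htriv E (α c)) := by
  let H (i : Fin s.card) : UnitaryRep G := α (s.equivFin.symm i).1
  have hbij (a : K) : Function.Bijective (piEval htriv E H a) := by
    refine ⟨piEval_injective htriv E H (fun i => UnitaryRep.isIrreducible_of_mk_eq (hα _))
      (fun i j hij => s.equivFin.symm.injective (Subtype.ext (Subtype.ext
        ((hα _).symm.trans (hij.trans (hα _)))))) a,
      piEval_surjective htriv E H a fun S hS hne => ?_⟩
    have hmk : RepClass.mk S = RepClass.mk (α ⟨RepClass.mk S, S, hS, rfl⟩) :=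
      (hα ⟨RepClass.mk S, S, hS, rfl⟩).symm
    -- Outside `s` the equivariant maps from the chosen representative vanish; composing with the
    -- equivalence `T` transfers this to maps from `S`, against `hne`.
    have hmem : (⟨RepClass.mk S, S, hS, rfl⟩ : Irr G) ∈ s := by
      by_contra hc
      obtain ⟨T, hT⟩ : S.Isomorphic _ := Quotient.exact hmk
      obtain ⟨t, ht⟩ := exists_ne (0 : (homBundle htriv (ofRep K S) E).fib a)
      have hsub := hs _ hc a
      apply ht
      refine homBundle_ext fun (v : S.V) => ?_
      let t' : (homBundle htriv (ofRep K (α ⟨RepClass.mk S, S, hS, rfl⟩)) E).fib a :=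
        (homFibEquiv htriv _ E a).symm
          ⟨(homFibEquiv htriv (ofRep K S) E a t).1 ∘ₗ T.symm.toLinearMap,
            fun g (v : (α ⟨RepClass.mk S, S, hS, rfl⟩).V) => by
            have h : T.symm ((α ⟨RepClass.mk S, S, hS, rfl⟩).ρ g v) = S.ρ g (T.symm v) := by
              rw [LinearEquiv.symm_apply_eq, hT, LinearEquiv.apply_symm_apply]
            exact (congrArg _ h).trans ((homFibEquiv htriv (ofRep K S) E a t).2 g _)⟩
      have h0 : t' = 0 := Subsingleton.elim _ _
      have h1 : (homFibEquiv htriv (ofRep K S) E a t).1 (T.symm (T v)) = 0 :=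
        congrArg (fun x => (homFibEquiv htriv _ E a x).1 (T v)) h0
      rw [LinearEquiv.symm_apply_apply] at h1
      exact h1
    refine ⟨s.equivFin ⟨_, hmem⟩, ?_⟩
    change _ = RepClass.mk (α _)
    rw [Equiv.symm_apply_apply]
    exact hmk
  have h1 : VNetG.mk (pi fun i => isotypic htriv E (H i)) = VNetG.mk E :=
    Quotient.sound ⟨fun a => LinearEquiv.ofBijective (piEval htriv E H a) (hbij a),
      fun a b h v => piEval_J htriv E H h v, fun g a b h v => by
        -- The action on `K` is trivial, so only the action within a single fibre has to be checked.
        obtain rfl : a = b := (htriv g a).symm.trans h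
        exact piEval_act htriv E H a g v⟩
  rw [← h1, mk_pi, ← Finset.sum_coe_sort s]
  exact Equiv.sum_comp s.equivFin.symm fun c : s => VNetG.mk (isotypic htriv E (α c.1))

end Decomposition

/-! ### Additivity of `B(D, -)_G` and its values on `T_H ⊗ E` -/

section HomBundle

variable (D : HilbertNetGBundle G K)

theorem homBundle_congr {E F : HilbertNetGBundle G K} (h : E.Isomorphic F) :
    (homBundle htriv D E).Isomorphic (homBundle htriv D F) := by
  obtain ⟨T, hJ, hact⟩ := h
  refine ⟨fun a => (homFibEquiv htriv D E a).trans (LinearEquiv.trans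
    { toFun := fun t => ⟨(T a).toLinearMap ∘ₗ t.1, fun g v =>
        (congrArg (T a) (t.2 g v)).trans (hact g a a (htriv g a) _)⟩
      invFun := fun t => ⟨(T a).symm.toLinearMap ∘ₗ t.1, fun g v => by
        refine (LinearEquiv.symm_apply_eq _).2 ((t.2 g v).trans ?_)
        refine Eq.trans ?_ (hact g a a (htriv g a) _).symm
        exact congrArg _ ((T a).apply_symm_apply _).symm⟩
      map_add' := fun s t => Subtype.ext (LinearMap.comp_add _ _ _)
      map_smul' := fun r t => Subtype.ext (LinearMap.comp_smul _ _ _)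
      left_inv := fun t => Subtype.ext (LinearMap.ext fun v => (T a).symm_apply_apply _)
      right_inv := fun t => Subtype.ext (LinearMap.ext fun v => (T a).apply_symm_apply _) }
    (homFibEquiv htriv D F a).symm), fun a b h t => ?_⟩
  exact homBundle_ext fun v => hJ a b h _

/-- The two projections of `E ⊕ F` are equivariant and commute with the net structures, so
equivariant maps into the sum are pairs of such maps. -/
theorem homBundle_sum (E F : HilbertNetGBundle G K) :
    (homBundle htriv D (E.sum F)).Isomorphic
      ((homBundle htriv D E).sum (homBundle htriv D F)) := by
  let e (a : K) : (E.sum F).fib a ≃ₗ[ℂ] E.fib a × F.fib a := WithLp.linearEquiv 2 ℂ _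
  refine ⟨fun a => (homFibEquiv htriv D (E.sum F) a).trans (LinearEquiv.trans
    (LinearEquiv.trans
      { toFun := fun t => (⟨LinearMap.fst ℂ _ _ ∘ₗ (e a).toLinearMap ∘ₗ t.1, fun g v =>
            congrArg (fun x => (e a x).1) (t.2 g v)⟩,
          ⟨LinearMap.snd ℂ _ _ ∘ₗ (e a).toLinearMap ∘ₗ t.1, fun g v =>
            congrArg (fun x => (e a x).2) (t.2 g v)⟩)
        invFun := fun t => ⟨(e a).symm.toLinearMap ∘ₗ t.1.1.prod t.2.1, fun g v =>
          (e a).injective (Prod.ext (t.1.2 g v) (t.2.2 g v))⟩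
        map_add' := fun s t => rfl
        map_smul' := fun r t => rfl
        left_inv := fun t => rfl
        right_inv := fun t => rfl }
      ((homFibEquiv htriv D E a).symm.prodCongr (homFibEquiv htriv D F a).symm))
    (WithLp.linearEquiv 2 ℂ _).symm), fun a b h t => rfl⟩

/-- The additive map `[E] ↦ [B(D, E)_G]`. -/
noncomputable def homCls : VNetG G K →+ K0 K where
  toFun := Quotient.lift (fun E => (homBundle htriv D E).cls) fun _ _ h =>
    congrArg GrothendieckRing.of (Quotient.sound (homBundle_congr htriv D h))
  map_zero' := by
    refine (congrArg GrothendieckRing.of (?_ : VNet.mk (homBundle htriv D zero) = 0)).trans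
      (map_zero _)
    have (a : K) : Subsingleton ((homBundle htriv D zero).fib a) :=
      ⟨fun s t => homBundle_ext fun v => Subsingleton.elim (α := EuclideanSpace ℂ (Fin 0)) _ _⟩
    exact Quotient.sound ⟨fun _ => LinearEquiv.ofSubsingleton _ (EuclideanSpace ℂ (Fin 0)),
      fun _ _ _ _ => Subsingleton.elim (α := EuclideanSpace ℂ (Fin 0)) _ _⟩
  map_add' := by
    rintro ⟨E⟩ ⟨F⟩
    have h : VNet.mk (homBundle htriv D (E.sum F))
        = VNet.mk (homBundle htriv D E) + VNet.mk (homBundle htriv D F) :=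
      Quotient.sound (homBundle_sum htriv D E F)
    exact (congrArg GrothendieckRing.of h).trans (map_add _ _ _)

theorem homCls_eq_zero {E : HilbertNetGBundle G K}
    (h : ∀ a, Subsingleton ((homBundle htriv D E).fib a)) :
    homCls htriv D (VNetG.mk E) = 0 := by
  refine (congrArg GrothendieckRing.of (?_ : VNet.mk (homBundle htriv D E) = 0)).trans
      (map_zero _)
  exact Quotient.sound ⟨fun _ => LinearEquiv.ofSubsingleton _ (EuclideanSpace ℂ (Fin 0)),
      fun _ _ _ _ => Subsingleton.elim (α := EuclideanSpace ℂ (Fin 0)) _ _⟩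

theorem tensor_ofTrivial_act (H : UnitaryRep G) (E : HilbertNetBundle K) (a : K) (g : G)
    (x : H.V ⊗[ℂ] E.fib a) :
    ((ofRep K H).tensor (ofTrivial htriv E)).act g (htriv g a) x
      = LinearMap.rTensor (E.fib a) (H.ρ g).toLinearEquiv.toLinearMap x :=
  tensMap_eq_rTensor _ (E.J_refl a) x

/-- The isomorphism sends `m` to the map `v ↦ v ⊗ m`: injective because `H` is non-zero, surjective
by Schur in the form `exists_tmul`. -/
theorem homCls_tensor_self {H : UnitaryRep G} (hH : H.IsIrreducible) (E : HilbertNetBundle K) :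
    homCls htriv (ofRep K H) (VNetG.mk ((ofRep K H).tensor (ofTrivial htriv E))) = E.cls := by
  refine congrArg GrothendieckRing.of (Eq.symm (Quotient.sound ?_))
  let f (a : K) : E.fib a →ₗ[ℂ]
      equivariantMaps htriv (ofRep K H) ((ofRep K H).tensor (ofTrivial htriv E)) a :=
    { toFun := fun m => ⟨(TensorProduct.mk ℂ H.V (E.fib a)).flip m, fun g v =>
        (tensor_ofTrivial_act htriv H E a g (v ⊗ₜ m)).symm⟩
      map_add' := fun m m' => Subtype.ext (map_add (TensorProduct.mk ℂ H.V (E.fib a)).flip m m')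
      map_smul' := fun r m =>
        Subtype.ext (map_smul (TensorProduct.mk ℂ H.V (E.fib a)).flip r m) }
  have hf (a : K) : Function.Bijective (f a) := by
    refine ⟨(injective_iff_map_eq_zero (f a)).2 fun m hm =>
      hH.eq_zero_of_tmul_eq_zero fun v => ?_, fun t => ?_⟩
    · exact LinearMap.congr_fun (congrArg Subtype.val hm) v
    · let t' : H.V →ₗ[ℂ] H.V ⊗[ℂ] E.fib a := t.1
      obtain ⟨m, hm⟩ := hH.exists_tmul t' fun g v => (t.2 g v).trans (tensor_ofTrivial_act htriv H E a g _)
      exact ⟨m, Subtype.ext (LinearMap.ext fun v => (hm v).symm)⟩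
  exact ⟨fun a => (LinearEquiv.ofBijective (f a) (hf a)).trans (homFibEquiv htriv _ _ a).symm,
    fun a b h m => homBundle_ext fun v => rfl⟩

/-- The off-diagonal case of Schur's lemma: every fibre of the Hom bundle is zero. -/
theorem homCls_tensor_of_mk_ne {H H' : UnitaryRep G} (hH : H.IsIrreducible)
    (hH' : H'.IsIrreducible) (hne : RepClass.mk H ≠ RepClass.mk H') (E : HilbertNetBundle K) :
    homCls htriv (ofRep K H) (VNetG.mk ((ofRep K H').tensor (ofTrivial htriv E))) = 0 := by
  refine homCls_eq_zero htriv _ fun a => ?_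
  have h0 (t : (homBundle htriv (ofRep K H) ((ofRep K H').tensor (ofTrivial htriv E))).fib a) :
      (homFibEquiv htriv _ _ a t).1 = 0 := by
    let t' : H.V →ₗ[ℂ] H'.V ⊗[ℂ] E.fib a := (homFibEquiv htriv _ _ a t).1
    exact hH.eq_zero_of_mk_ne hH' hne t' fun g v => ((homFibEquiv htriv _ _ a t).2 g v).trans (tensor_ofTrivial_act htriv H' E a g _)
  exact ⟨fun s t => (homFibEquiv htriv _ _ a).injective (Subtype.ext ((h0 s).trans (h0 t).symm))⟩

end HomBundle

/-! ### The inverse of `Φ` -/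

section Inverse

variable (hK : PathwiseConnected K) {α : Irr G → UnitaryRep G}
  (hα : ∀ c, RepClass.mk (α c) = c.1)

include hK hα in
theorem finite_support_homCls (x : VNetG G K) :
    (Function.support fun c => homCls htriv (ofRep K (α c)) x ⊗ₜ[ℤ] (α c).cls).Finite := by
  obtain ⟨E, rfl⟩ : ∃ E, VNetG.mk E = x := Quotient.exists_rep x
  obtain ⟨s, hs⟩ := exists_finset_subsingleton_hom htriv hα E hK
  refine s.finite_toSet.subset fun c hc => ?_
  by_contra h
  exact hc (by simp only [homCls_eq_zero htriv _ (hs c h), TensorProduct.zero_tmul])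

/-- The additive map `[E] ↦ ∑ [B(T_c, E)_G] ⊗ [H_c]`. -/
noncomputable def isotypicHom : K0G G K →+ K0 K ⊗[ℤ] RepRing G :=
  GrothendieckRing.lift
    -- Summing over all of `Irr G` gives one formula valid for `x`, `y` and `x + y`. As `∑ᶠ` is zero
    -- by default on infinite supports, additivity depends on `finite_support_homCls`.
    { toFun := fun x => ∑ᶠ c, homCls htriv (ofRep K (α c)) x ⊗ₜ[ℤ] (α c).cls
      map_zero' := by simp
      map_add' := fun x y => by
        simp only [map_add, TensorProduct.add_tmul]
        exact finsum_add_distrib (finite_support_homCls htriv hK hα x)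
          (finite_support_homCls htriv hK hα y) }

theorem isotypicHom_cls (E : HilbertNetGBundle G K) :
    isotypicHom htriv hK hα E.cls
      = ∑ᶠ c, homCls htriv (ofRep K (α c)) (VNetG.mk E) ⊗ₜ[ℤ] (α c).cls :=
  GrothendieckRing.lift_of _ _

/-- By the two Schur computations only the term with index `c` survives. -/
theorem isotypicHom_tensorToK0G_irreducible (E : HilbertNetBundle K) (c : Irr G) :
    isotypicHom htriv hK hα (tensorToK0G htriv (E.cls ⊗ₜ[ℤ] (α c).cls))
      = E.cls ⊗ₜ[ℤ] (α c).cls := by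
  rw [tensorToK0G_tmul, isotypicHom_cls, finsum_eq_single _ c,
    homCls_tensor_self htriv (UnitaryRep.isIrreducible_of_mk_eq (hα c))]
  intro d hd
  rw [homCls_tensor_of_mk_ne htriv (UnitaryRep.isIrreducible_of_mk_eq (hα d))
    (UnitaryRep.isIrreducible_of_mk_eq (hα c)), TensorProduct.zero_tmul]
  rw [hα, hα]
  exact fun h => hd (Subtype.ext h)

theorem isotypicHom_tensorToK0G (z : K0 K ⊗[ℤ] RepRing G) :
    isotypicHom htriv hK hα (tensorToK0G htriv z) = z := by
  have key (E : HilbertNetBundle K) : ∀ r : RepRing G,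
      isotypicHom htriv hK hα (tensorToK0G htriv (E.cls ⊗ₜ[ℤ] r)) = E.cls ⊗ₜ[ℤ] r := by
    -- For fixed `E` both sides are additive in `r`, so it suffices to take classes of
    -- representations, and then irreducible ones, which generate them.
    refine DFunLike.congr_fun (f := (isotypicHom htriv hK hα).comp
      ((tensorToK0G htriv).toRingHom.toAddMonoidHom.comp
        (TensorProduct.mk ℤ (K0 K) (RepRing G) E.cls).toAddMonoidHom))
      (g := (TensorProduct.mk ℤ (K0 K) (RepRing G) E.cls).toAddMonoidHom)
      (GrothendieckRing.addHom_ext fun x => ?_)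
    obtain ⟨H, rfl⟩ : ∃ H, RepClass.mk H = x := Quotient.exists_rep x
    change isotypicHom htriv hK hα (tensorToK0G htriv (E.cls ⊗ₜ[ℤ] GrothendieckRing.of _))
      = E.cls ⊗ₜ[ℤ] GrothendieckRing.of _
    generalize RepClass.mk H = x, H.mk_mem_closure_irreducible = hx
    induction hx using AddSubmonoid.closure_induction with
    | mem x hx =>
      have := isotypicHom_tensorToK0G_irreducible htriv hK hα E ⟨x, hx⟩
      rw [UnitaryRep.cls, hα] at this
      exact this
    | zero => simp only [map_zero, TensorProduct.tmul_zero]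
    | add x y _ _ hx hy => simp only [map_add, TensorProduct.tmul_add, hx, hy]
  induction z with
  | zero => simp only [map_zero]
  | add x y hx hy => simp only [map_add, hx, hy]
  | tmul x r =>
    obtain ⟨⟨E⟩, ⟨F⟩, rfl⟩ := GrothendieckRing.exists_sub x
    rw [TensorProduct.sub_tmul, map_sub, map_sub]
    exact congrArg₂ _ (key E r) (key F r)

include hα in
-- This is the isotypic decomposition read in `K0G G K`: each term on the left goes to the class of
-- one isotypic bundle.
theorem tensorToK0G_sum {E : HilbertNetGBundle G K} {s : Finset (Irr G)}
    (hs : ∀ c ∉ s, ∀ a, Subsingleton ((homBundle htriv (ofRep K (α c)) E).fib a)) :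
    tensorToK0G htriv (∑ c ∈ s, (homBundle htriv (ofRep K (α c)) E).cls ⊗ₜ[ℤ] (α c).cls)
      = E.cls := by
  rw [cls, mk_eq_sum_isotypic htriv hα E hs, map_sum, map_sum]
  exact Finset.sum_congr rfl fun c _ => tensorToK0G_tmul htriv _ _

include hK in
-- Injective because `isotypicHom` is a left inverse; surjective because the range is closed under
-- differences and contains the class of every bundle.
theorem tensorToK0G_bijective : Function.Bijective (tensorToK0G (K := K) htriv) := by
  have hex (c : Irr G) : ∃ H, RepClass.mk H = c.1 := Quotient.exists_rep _
  choose α hα using hex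
  have hcls (x : VNetG G K) :
      (GrothendieckRing.of x : K0G G K) ∈ (tensorToK0G (K := K) htriv).range := by
    obtain ⟨E, rfl⟩ : ∃ E, VNetG.mk E = x := Quotient.exists_rep x
    obtain ⟨s, hs⟩ := exists_finset_subsingleton_hom htriv hα E hK
    exact ⟨_, tensorToK0G_sum htriv hα hs⟩
  refine ⟨Function.LeftInverse.injective (isotypicHom_tensorToK0G htriv hK hα), fun z => ?_⟩
  obtain ⟨x, y, rfl⟩ := GrothendieckRing.exists_sub z
  exact sub_mem (hcls x) (hcls y)

end Inverse

end HilbertNetGBundle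

end

theorem theorem5p22 {K : Type u} [PartialOrder K] (hK : PathwiseConnected K)
    {G : Type v} [Group G] [TopologicalSpace G] [IsTopologicalGroup G] [CompactSpace G]
    [MulAction G K] (htriv : ∀ (g : G) (a : K), g • a = a) :
    ∃ Φ : (K0 K ⊗[ℤ] RepRing G) ≃+* K0G G K,
      (∀ (E : HilbertNetBundle K) (H : UnitaryRep G),
        Φ (E.cls ⊗ₜ[ℤ] H.cls) =
          ((HilbertNetGBundle.ofRep K H).tensor (HilbertNetGBundle.ofTrivial htriv E)).cls) ∧
      ∀ α : Irr G → UnitaryRep G, (∀ c, RepClass.mk (α c) = c.1) →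
        ∀ E : HilbertNetGBundle G K, ∃ s : Finset (Irr G),
          (∀ c ∉ s, ∀ a, Subsingleton
            ((HilbertNetGBundle.homBundle htriv (HilbertNetGBundle.ofRep K (α c)) E).fib a)) ∧
          VNetG.mk E =
            ∑ c ∈ s, VNetG.mk ((HilbertNetGBundle.ofRep K (α c)).tensor
              (HilbertNetGBundle.ofTrivial htriv
                (HilbertNetGBundle.homBundle htriv (HilbertNetGBundle.ofRep K (α c)) E))) ∧
          Φ.symm E.cls =
            ∑ c ∈ s, (HilbertNetGBundle.homBundle htriv (HilbertNetGBundle.ofRep K (α c)) E).cls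
              ⊗ₜ[ℤ] (α c).cls := by
  refine ⟨RingEquiv.ofBijective (tensorToK0G htriv)
    (HilbertNetGBundle.tensorToK0G_bijective htriv hK), tensorToK0G_tmul htriv, fun α hα E => ?_⟩
  obtain ⟨s, hs⟩ := HilbertNetGBundle.exists_finset_subsingleton_hom htriv hα E hK
  refine ⟨s, hs, HilbertNetGBundle.mk_eq_sum_isotypic htriv hα E hs, ?_⟩
  -- After applying `Φ`, the formula for the inverse becomes the decomposition itself.
  rw [RingEquiv.symm_apply_eq]
  exact (HilbertNetGBundle.tensorToK0G_sum htriv hα hs).symm
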